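/- **Setting.** Let $(\mathcal S,\mathcal S^{\rm init},\mathcal S^{\rm end},\mathcal A,P,R,\Gamma)$ be a finite Markov decision process: $\mathcal S$ and $\mathcal A\subseteq\mathcal A_1\times\dots\times\mathcal A_K$ are finite, $\mathcal S^{\rm init}\subseteq\mathcal S\setminus\mathcal S^{\rm end}$, and $\mathcal A(s)\subseteq\mathcal A$ is the set of actions available in $s$, with $\mathcal A=\bigcup_s\mathcal A(s)$. Each factor $\mathcal A_k$ contains an ending element. $\mathcal A^{\rm end}$ is the set of actions with at least one ending coordinate; it is contained in every $\mathcal A(s)$, and the tuple of all ending elements belongs to $\mathcal A$. The transition probabilities satisfy $P(s,a,s')\ge 0$ and $\sum_{s'}P(s,a,s')\le 1$ (missing mass is the probability that the run is lost and never stops at a state), the rewards are $R(s,a,s')\in\mathbb R$, and the discounts are $\Gamma(s,a,s')\in[0,1]$; $R$ and $\Gamma$ matter only where $P(s,a,s')>0$. For $a\in\mathcal A^{\rm end}$ one has $P(s,a,s')=\mathbf 1_{\{s'=s\}}$ and $\Gamma(s,a,s)=1$, and $R(s,a,s)=r$ if $s\notin\mathcal S^{\rm end}$, where $r<0$ is a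 constant; moreover $R(s,\cdot,\cdot)=0$ for $s\in\mathcal S^{\rm end}$. Let $\pi$ be a policy, i.e. $\pi(s,a)\ge 0$ and $\sum_{a\in\mathcal A(s)}\pi(s,a)=1$ for every $s$, with $\sum_{a\in\mathcal A^{\rm end}}\pi(s,a)=1$ for $s\in\mathcal S^{\rm end}$, and let $t\in[1,\infty]$ be its timescale, with $1/\infty:=0$. **Compressed quantities.** Run $\pi$ from $S_0=s$: given $S_n$, draw $A_{n+1}\sim\pi(S_n,\cdot)$ and then $S_{n+1}\sim P(S_n,A_{n+1},\cdot)$. Let $\tau_0$ be independent of the run and geometric on $\{1,2,\dots\}$ with parameter $1/t$ ($\tau_0=\infty$ if $t=\infty$), and let $\tau=\min\{\tau_0,\min\{n:A_n\in\mathcal A^{\rm end}\}\}$. Put $$P^+(s,\pi,s')=\mathbb P[\tau<\infty,\ S_\tau=s'\mid S_0=s],\qquad R_{0,\tau}=\sum_{n=0}^{\tau-1}\Big[\prod_{m=0}^{n-1}\Gamma(S_m,A_{m+1},S_{m+1})\Big]R(S_n,A_{n+1},S_{n+1}),$$ and, whenever $P^+(s,\pi,s')>0$, let $R^+(s,\pi,s')=0$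 if $s\in\mathcal S^{\rm end}$, and $R^+(s,\pi,s')=\mathbb E[R_{0,\tau}\mid S_0=s,\ \tau<\infty,\ S_\tau=s']$ otherwise. **Notation.** Let $P^\pi_{\rm end}(s,s'')=\sum_{a\in\mathcal A^{\rm end}}P(s,a,s'')\pi(s,a)$ and $[(X\circ Y)^\pi]_{s,s''}=\sum_{a\in\mathcal A(s)}X(s,a,s'')Y(s,a,s'')\pi(s,a)$. Fix $s'\in\mathcal S$, let $\mathcal S_{s'}=\{s: P^+(s,\pi,s')>0\}$, and for $s\in\mathcal S_{s'}$ put $$P_{s'}(s,a,s'')=\frac{P(s,a,s'')P^+(s'',\pi,s')}{P^+(s,\pi,s')},\qquad \overline P_{s'}(s,a,s'')=\frac{P(s,a,s'')}{P^+(s,\pi,s')}.$$ **Proposition.** For every $s'\in\mathcal S$: for each $s\in\mathcal S_{s'}$ the variable $R_{0,\tau}$ is integrable given $\{S_0=s,\tau<\infty,S_\tau=s'\}$, and $R^+(s,\pi,s')$ is its conditional expectation (also when $s\in\mathcal S^{\rm end}$). The vector $(R^+(s,\pi,s'))_{s\in\mathcal S_{s'}}$ is bounded and is the unique solution $h\in\mathbb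 R^{\mathcal S_{s'}}$ of the linear system $$\Big[1+\big(1-\tfrac1t\big)\big(P^\pi_{\rm end}-(P_{s'}\circ\Gamma)^\pi\big)\Big]h=\big(1-\tfrac1t\big)\Big[(P_{s'}\circ R)^\pi\underline 1-r\,P^\pi_{\rm end}\underline 1+r\,\mathrm{diag}\big(P^+(\cdot,\pi,s')\big)^{-1}P^\pi_{\rm end}v_{s'}\Big]+\tfrac1t(\overline P_{s'}\circ R)^\pi v_{s'},$$ whose rows are indexed by $\mathcal S_{s'}$. Here the columns of the matrices applied to $h$ and to the all-ones vector $\underline 1$ are restricted to $\mathcal S_{s'}$, and $v_{s'}\in\mathbb R^{\mathcal S}$ is the indicator vector of $s'$. -/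

import Mathlib

open MeasureTheory ProbabilityTheory
open scoped ENNReal BigOperators Matrix

noncomputable section

namespace CompressMDP

/-- A finite Markov decision process with state space `S`, set of all actions `A`, and `K` action
factors.  `coord` realizes `A` as a subset of the product of the factors, and `endElt k` is the
special element of the `k`-th factor that is used to end a policy.

Transition rows may have total mass below one: this happens for a higher-level MDP, whose actions
are policies that may run forever with positive probability.  The missing mass is the probability
that the run never comes back.

`R` and `Γ` are only meaningful at triples of positive transition probability, so that all
requirements are imposed at these triples only. -/
structure MDP (S A : Type*) [Fintype S] [DecidableEq S] [Fintype A]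
    (K : ℕ) (Factor : Fin K → Type*) where
  /-- initial states -/
  init : Set S
  /-- terminal states -/
  term : Set S
  init_disjoint : Disjoint init term
  /-- coordinates of an action in the action factors -/
  coord : A → ∀ k, Factor k
  coord_injective : Function.Injective coord
  /-- the special ending element of each factor -/
  endElt : ∀ k, Factor k
  /-- the action all of whose coordinates are the ending elements -/
  endAct : A
  endAct_coord : ∀ k, coord endAct k = endElt k
  /-- actions available in a state -/
  avail : S → Finset A
  avail_cover : ∀ a, ∃ s, a ∈ avail s
  /-- every action with at least one ending coordinate is available everywhere -/
  end_avail : ∀ s a, (∃ k, coord a k = endElt k) → a ∈ avail s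
  /-- transition probabilities -/
  P : S → A → S → ℝ
  P_nonneg : ∀ s, ∀ a ∈ avail s, ∀ s', 0 ≤ P s a s'
  P_sum_le : ∀ s, ∀ a ∈ avail s, ∑ s', P s a s' ≤ 1
  P_end : ∀ s a s', (∃ k, coord a k = endElt k) → P s a s' = if s' = s then 1 else 0
  /-- rewards -/
  R : S → A → S → ℝ
  /-- reward for choosing an ending action at a non-terminal state -/
  r : ℝ
  r_neg : r < 0
  R_term : ∀ s ∈ term, ∀ a ∈ avail s, ∀ s', 0 < P s a s' → R s a s' = 0
  R_end : ∀ s, s ∉ term → ∀ a, (∃ k, coord a k = endElt k) → ∀ s', 0 < P s a s' → R s a s' = r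
  /-- discount factors -/
  Γ : S → A → S → ℝ
  Γ_nonneg : ∀ s, ∀ a ∈ avail s, ∀ s', 0 < P s a s' → 0 ≤ Γ s a s'
  Γ_le_one : ∀ s, ∀ a ∈ avail s, ∀ s', 0 < P s a s' → Γ s a s' ≤ 1
  Γ_end : ∀ s a, (∃ k, coord a k = endElt k) → ∀ s', 0 < P s a s' → Γ s a s' = 1

variable {S A : Type*} [Fintype S] [DecidableEq S] [Fintype A]
  {K : ℕ} {Factor : Fin K → Type*}

/-- Actions with at least one coordinate equal to the ending element. -/
def MDP.IsEnd (M : MDP S A K Factor) (a : A) : Prop := ∃ k, M.coord a k = M.endElt k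

open Classical in
/-- The finite set of all ending actions. -/
def MDP.endActions (M : MDP S A K Factor) : Finset A := Finset.univ.filter M.IsEnd

/-- A policy: a probability on the available actions of each state, which selects ending actions
only at the terminal states. -/
structure Policy (M : MDP S A K Factor) where
  prob : S → A → ℝ
  nonneg : ∀ s, ∀ a ∈ M.avail s, 0 ≤ prob s a
  sum_eq_one : ∀ s, ∑ a ∈ M.avail s, prob s a = 1
  sum_end : ∀ s ∈ M.term, ∑ a ∈ M.endActions, prob s a = 1

/-! ### The run of a policy -/

/-- What is recorded at time `n`: the action `A_n` that led to the state `S_n`, and `S_n` itself.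
The action is `none` at time `0` and once the run is lost, and the state is `none` once the run is
lost, i.e. has left the state space through missing transition mass. -/
@[ext]
structure Obs (S A : Type*) where
  action : Option A
  state : Option S

instance : MeasurableSpace (Obs S A) := ⊤

instance : DiscreteMeasurableSpace (Obs S A) := ⟨fun _ => trivial⟩

/-- Law of the next record `(A_{n+1}, S_{n+1})` given the current one. -/
def stepMeasure (M : MDP S A K Factor) (π : Policy M) (x : Obs S A) : Measure (Obs S A) :=
  match x.state with
  | none => Measure.dirac ⟨none, none⟩
  | some s => ∑ a ∈ M.avail s, ENNReal.ofReal (π.prob s a) •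
      (∑ s'', ENNReal.ofReal (M.P s a s'') • Measure.dirac (⟨some a, some s''⟩ : Obs S A)
        + ENNReal.ofReal (1 - ∑ s'', M.P s a s'') • Measure.dirac (⟨some a, none⟩ : Obs S A))

theorem isProbabilityMeasure_stepMeasure (M : MDP S A K Factor) (π : Policy M) (x : Obs S A) :
    IsProbabilityMeasure (stepMeasure M π x) := by
  constructor
  unfold stepMeasure
  split
  · simp
  · rename_i s _
    have h : ∀ a ∈ M.avail s, ENNReal.ofReal (π.prob s a) *
        (∑ s'', ENNReal.ofReal (M.P s a s'') + ENNReal.ofReal (1 - ∑ s'', M.P s a s''))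
        = ENNReal.ofReal (π.prob s a) := by
      intro a ha
      rw [← ENNReal.ofReal_sum_of_nonneg (fun s'' _ => M.P_nonneg s a ha s''),
        ← ENNReal.ofReal_add (Finset.sum_nonneg fun s'' _ => M.P_nonneg s a ha s'')
          (sub_nonneg.2 (M.P_sum_le s a ha))]
      simp
    simp only [Measure.coe_finsetSum, Finset.sum_apply, Measure.smul_apply, Measure.add_apply,
      smul_eq_mul, measure_univ, mul_one]
    rw [Finset.sum_congr rfl h, ← ENNReal.ofReal_sum_of_nonneg (π.nonneg s), π.sum_eq_one s]
    simp

/-- One step of the run, as a Markov kernel. -/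
def stepKernel (M : MDP S A K Factor) (π : Policy M) : Kernel (Obs S A) (Obs S A) where
  toFun := stepMeasure M π
  measurable' := Measurable.of_discrete

instance (M : MDP S A K Factor) (π : Policy M) : IsMarkovKernel (stepKernel M π) :=
  ⟨isProbabilityMeasure_stepMeasure M π⟩

/-- The step kernel as a function of the whole history up to time `n`. -/
def histKernel (M : MDP S A K Factor) (π : Policy M) (n : ℕ) :
    Kernel (∀ _ : Finset.Iic n, Obs S A) (Obs S A) :=
  (stepKernel M π).comap (fun x => x ⟨n, Finset.mem_Iic.2 le_rfl⟩) (measurable_pi_apply _)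

instance (M : MDP S A K Factor) (π : Policy M) (n : ℕ) : IsMarkovKernel (histKernel M π n) := by
  unfold histKernel; infer_instance

/-- Law of the infinite trajectory `((A_n, S_n))_n` with `S_0 = s`. -/
def trajMeasure (M : MDP S A K Factor) (π : Policy M) (s : S) : Measure (ℕ → Obs S A) :=
  Kernel.traj (X := fun _ => Obs S A) (histKernel M π) 0 (fun _ => ⟨none, some s⟩)

/-- Stopping probability `1 / t` per step of a timescale `t ∈ [1, ∞]`, with `1 / ∞ = 0`. -/
def stopProb (t : ℝ≥0∞) : ℝ := (t⁻¹).toReal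

/-- Geometric law on `{1, 2, …}` with parameter `q`; the point mass at `∞` if `q = 0`. -/
def geoMeasure (q : ℝ) : Measure ℕ∞ :=
  if q = 0 then Measure.dirac ⊤
  else Measure.sum fun n : ℕ =>
    ENNReal.ofReal ((1 - q) ^ n * q) • Measure.dirac ((n + 1 : ℕ) : ℕ∞)

/-- Joint law of the trajectory started at `s` and of the independent geometric time `τ₀`. -/
def runMeasure (M : MDP S A K Factor) (π : Policy M) (t : ℝ≥0∞) (s : S) :
    Measure ((ℕ → Obs S A) × ℕ∞) :=
  (trajMeasure M π s).prod (geoMeasure (stopProb t))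

/-- The first time `n` at which the action `A_n` is an ending one (`∞` if there is none). -/
def firstEnd (M : MDP S A K Factor) (x : ℕ → Obs S A) : ℕ∞ :=
  ⨅ (n : ℕ) (_ : ∃ a, (x n).action = some a ∧ M.IsEnd a), (n : ℕ∞)

/-- The time `τ = min (τ₀, first time an ending action is chosen)`. -/
def stopTime (M : MDP S A K Factor) (ω : (ℕ → Obs S A) × ℕ∞) : ℕ∞ := min ω.2 (firstEnd M ω.1)

/-- The event `{τ < ∞, S_τ = s'}`. -/
def stopsAt (M : MDP S A K Factor) (s' : S) : Set ((ℕ → Obs S A) × ℕ∞) :=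
  {ω | ∃ n : ℕ, stopTime M ω = n ∧ (ω.1 n).state = some s'}

/-- The value `F (S_n, A_{n+1}, S_{n+1})` of a function of triples along a trajectory. -/
def along (F : S → A → S → ℝ) (x : ℕ → Obs S A) (n : ℕ) : ℝ :=
  match (x n).state, (x (n + 1)).action, (x (n + 1)).state with
  | some s, some a, some s'' => F s a s''
  | _, _, _ => 0

/-- The discounted reward accumulated over `[T, T']`. -/
def cumReward (M : MDP S A K Factor) (x : ℕ → Obs S A) (T T' : ℕ) : ℝ :=
  ∑ n ∈ Finset.Ico T T', (∏ m ∈ Finset.Ico T n, along M.Γ x m) * along M.R x n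

/-- `R_{0,τ}`.  (The value where `τ = ∞` plays no role.) -/
def stoppedReward (M : MDP S A K Factor) (ω : (ℕ → Obs S A) × ℕ∞) : ℝ :=
  cumReward M ω.1 0 (stopTime M ω).toNat

/-! ### The compressed quantities -/

/-- Compressed transition probability `P⁺(s, π, s')`: the probability that the run of `π` from `s`
stops at `s'`. -/
def compP (M : MDP S A K Factor) (π : Policy M) (t : ℝ≥0∞) (s s' : S) : ℝ :=
  (runMeasure M π t s (stopsAt M s')).toReal

/-- The expectation of `R_{0,τ}` for the run of `π` from `s`, given `S_τ = s'`. -/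
def condReward (M : MDP S A K Factor) (π : Policy M) (t : ℝ≥0∞) (s s' : S) : ℝ :=
  ∫ ω, stoppedReward M ω ∂(ProbabilityTheory.cond (runMeasure M π t s) (stopsAt M s'))

open Classical in
/-- Compressed reward `R⁺(s, π, s')`: zero at the terminal states, and otherwise the conditional
expectation of `R_{0,τ}` given `S_τ = s'`. -/
def compR (M : MDP S A K Factor) (π : Policy M) (t : ℝ≥0∞) (s s' : S) : ℝ :=
  if s ∈ M.term then 0 else condReward M π t s s'

/-! ### The linear system -/

/-- The transition matrix of `π` restricted to the ending actions. -/
def endMatrix (M : MDP S A K Factor) (π : Policy M) : Matrix S S ℝ :=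
  Matrix.of fun s s' => ∑ a ∈ M.endActions, M.P s a s' * π.prob s a

/-- The matrix `(X ∘ Y)^π`: the `π`-average of the pointwise product. -/
def hadamardAvg (M : MDP S A K Factor) (π : Policy M) (X Y : S → A → S → ℝ) : Matrix S S ℝ :=
  Matrix.of fun s s' => ∑ a ∈ M.avail s, X s a s' * Y s a s' * π.prob s a

/-- `P_{s'}(s, a, s'') = P(s, a, s'') P⁺(s'', π, s') / P⁺(s, π, s')`. -/
def doobP (M : MDP S A K Factor) (π : Policy M) (t : ℝ≥0∞) (s' : S) : S → A → S → ℝ :=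
  fun s a s'' => M.P s a s'' * compP M π t s'' s' / compP M π t s s'

/-- `P̄_{s'}(s, a, s'') = P(s, a, s'') / P⁺(s, π, s')`. -/
def doobPbar (M : MDP S A K Factor) (π : Policy M) (t : ℝ≥0∞) (s' : S) : S → A → S → ℝ :=
  fun s a s'' => M.P s a s'' / compP M π t s s'

/-- The states from which stopping at `s'` has positive probability. -/
abbrev Supp (M : MDP S A K Factor) (π : Policy M) (t : ℝ≥0∞) (s' : S) : Type _ :=
  {s : S // 0 < compP M π t s s'}

/-- Restriction of a matrix to the rows and columns in the support. -/
def restrictSq (M : MDP S A K Factor) (π : Policy M) (t : ℝ≥0∞) (s' : S) (B : Matrix S S ℝ) :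
    Matrix (Supp M π t s') (Supp M π t s') ℝ :=
  B.submatrix Subtype.val Subtype.val

/-- Restriction of a matrix to the rows in the support. -/
def restrictRows (M : MDP S A K Factor) (π : Policy M) (t : ℝ≥0∞) (s' : S) (B : Matrix S S ℝ) :
    Matrix (Supp M π t s') S ℝ :=
  B.submatrix Subtype.val id

/-- `h` solves the linear system of the compressed reward with target state `s'`. -/
def SolvesRewardSystem (M : MDP S A K Factor) (π : Policy M) (t : ℝ≥0∞) (s' : S)
    (h : Supp M π t s' → ℝ) : Prop :=
  (1 + (1 - stopProb t) • (restrictSq M π t s' (endMatrix M π)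
      - restrictSq M π t s' (hadamardAvg M π (doobP M π t s') M.Γ))) *ᵥ h
  = (1 - stopProb t) • (restrictSq M π t s' (hadamardAvg M π (doobP M π t s') M.R) *ᵥ 1
      - M.r • (restrictSq M π t s' (endMatrix M π) *ᵥ 1)
      + M.r • ((Matrix.diagonal fun s : Supp M π t s' => compP M π t s s')⁻¹ *ᵥ
          (restrictRows M π t s' (endMatrix M π) *ᵥ Pi.single s' 1)))
    + stopProb t •
      (restrictRows M π t s' (hadamardAvg M π (doobPbar M π t s') M.R) *ᵥ Pi.single s' 1)

end CompressMDP

end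

/-!
Only the states from which `s'` can be reached matter, and on the event `{τ < ∞, S_τ = s'}` one
works with expectations instead of conditional ones: let `w s = 𝔼[R_{0,τ} ; τ < ∞, S_τ = s']` for
the run from `s`, so that `w s = P⁺(s, π, s') * R⁺(s, π, s')`.

Since `τ₀` is geometric, the run stops at each record with a probability that only depends on that
record: `1` at an ending action and `1 / t` elsewhere. Hence `τ` can be replaced by weights along a
Markov chain, and conditioning on the first step yields `P⁺ = H δ + Q P⁺`, where `H` is the matrix
of the transitions at which the run stops, `Q` that of the transitions at which it goes on, and `δ`
the indicator of `s'`, as well as `w = H_R δ + (Q_R P⁺ + Q_Γ w)`, where the index means that the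
transitions are weighted with their rewards or discounts. Multiplying the row of `s` of the linear
system by `P⁺(s, π, s')` turns it into the second equation.

Nothing here requires `τ` to be finite, nor `Q` to be a strict contraction. What replaces this is
`P⁺ = ∑ Qⁿ H δ`, so that `Qⁿ P⁺` decreases to `0`. As the state space is finite, some power `Qᵏ`
halves `P⁺`, and the decay is geometric: therefore `𝔼[τ ; τ < ∞, S_τ = s'] < ∞`, which makes
`R_{0,τ}` integrable. For the uniqueness, the difference `D` of two solutions, multiplied by `P⁺`,
satisfies `|D| ≤ Q |D|` and `|D| ≤ C P⁺`, hence `|D| ≤ Qⁿ |D| ≤ C Qⁿ P⁺ → 0`.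
-/

noncomputable section

namespace CompressMDP

section Chain

variable {E : Type*}

/-- Prepend a point to a sequence. -/
def seqCons (x : E) (z : ℕ → E) : ℕ → E
  | 0 => x
  | n + 1 => z n

/-- The sequence `z` up to time `n`, continued by the constant `e`.  Functions of a finite initial
segment of `z` are thus treated as functions of sequences. -/
def continueConst (n : ℕ) (z : ℕ → E) (e : E) : ℕ → E := fun i => if i ≤ n then z i else e

theorem continueConst_zero (z : ℕ → E) (e : E) :
    continueConst 0 z e = seqCons (z 0) fun _ => e := by
  ext i; cases i <;> simp [continueConst, seqCons]

theorem continueConst_succ_seqCons (n : ℕ) (x : E) (z : ℕ → E) (e : E) :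
    continueConst (n + 1) (seqCons x z) e = seqCons x (continueConst n z e) := by
  ext i; cases i <;> simp [continueConst, seqCons]

theorem continueConst_succ_continueConst (n : ℕ) (z : ℕ → E) (e : E) :
    continueConst (n + 1) (continueConst n z (z (n + 1))) e = continueConst (n + 1) z e := by
  ext i
  rcases lt_trichotomy i (n + 1) with h | rfl | h
  · simp [continueConst, h.le, Nat.lt_succ_iff.1 h]
  · simp [continueConst]
  · simp [continueConst, h.not_ge]

variable [MeasurableSpace E]

@[fun_prop]
theorem measurable_seqCons : Measurable fun p : E × (ℕ → E) => seqCons p.1 p.2 :=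
  measurable_pi_lambda _ fun n => by cases n <;> simp only [seqCons] <;> fun_prop

@[fun_prop]
theorem measurable_seqCons_right (x : E) : Measurable (seqCons x) :=
  measurable_seqCons.comp measurable_prodMk_left

@[fun_prop]
theorem measurable_continueConst (n : ℕ) :
    Measurable fun p : (ℕ → E) × E => continueConst n p.1 p.2 :=
  measurable_pi_lambda _ fun i => by
    by_cases h : i ≤ n <;> simp only [continueConst, h, if_true, if_false] <;> fun_prop

/-- The law of the trajectory of the homogeneous Markov chain with transition kernel `κ`, as a
function of the initial point. -/
def chain (κ : Kernel E E) [IsMarkovKernel κ] : Kernel E (ℕ → E) :=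
  (Kernel.traj (X := fun _ => E)
    (fun n => κ.comap (fun y : (∀ _ : Finset.Iic n, E) => y ⟨n, Finset.mem_Iic.2 le_rfl⟩)
      (measurable_pi_apply _)) 0).comap (fun x _ => x) (by fun_prop)

variable (κ : Kernel E E) [IsMarkovKernel κ]

instance : IsMarkovKernel (chain κ) := by unfold chain; infer_instance

theorem map_chain_zero (x : E) : (chain κ x).map (fun z => z 0) = .dirac x := by
  have h : (chain κ x).map (Preorder.frestrictLe (π := fun _ => E) 0) = .dirac fun _ => x := by
    rw [chain, Kernel.comap_apply, Kernel.traj_map_frestrictLe_apply, Kernel.partialTraj_self,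
      Kernel.id_apply]
  have h' := congrArg (Measure.map fun w => w ⟨0, Finset.mem_Iic.2 le_rfl⟩) h
  rwa [Measure.map_map (by fun_prop) (by fun_prop), Measure.map_dirac' (by fun_prop)] at h'

theorem lintegral_chain_zero (x : E) {f : E → ℝ≥0∞} (hf : Measurable f) :
    ∫⁻ z, f (z 0) ∂chain κ x = f x := by
  rw [← lintegral_map (f := f) hf (by fun_prop), map_chain_zero, lintegral_dirac' _ hf]

theorem lintegral_chain_succ (x : E) (n : ℕ) {f : (ℕ → E) → ℝ≥0∞} (hf : Measurable f) :
    ∫⁻ z, f (continueConst n z (z (n + 1))) ∂chain κ x =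
      ∫⁻ z, ∫⁻ e, f (continueConst n z e) ∂κ (z n) ∂chain κ x := by
  let κ' (k : ℕ) : Kernel (∀ _ : Finset.Iic k, E) E :=
    κ.comap (fun y => y ⟨k, Finset.mem_Iic.2 le_rfl⟩) (measurable_pi_apply _)
  let extend (p : (∀ _ : Finset.Iic n, E) × E) (i : ℕ) : E :=
    if h : i ≤ n then p.1 ⟨i, Finset.mem_Iic.2 h⟩ else p.2
  have extend_eq (z : ℕ → E) (e : E) :
      extend (Preorder.frestrictLe (π := fun _ => E) n z, e) = continueConst n z e := by
    ext i; by_cases h : i ≤ n <;> simp [extend, continueConst, h]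
  have hextend : Measurable extend := measurable_pi_lambda _ fun i => by
    by_cases h : i ≤ n <;> simp only [extend, h, dite_true, dite_false] <;> fun_prop
  have hmarkov := congrArg (fun μ => ∫⁻ p, f (extend p) ∂μ)
    (Kernel.partialTraj_compProd_eq_map_traj (X := fun _ => E) (κ := κ') n.zero_le
      (x₀ := fun _ => x))
  have hfext : Measurable fun p => f (extend p) := hf.comp hextend
  have hinner : Measurable fun w => ∫⁻ e, f (extend (w, e)) ∂κ' n w :=
    hfext.lintegral_kernel_prod_right'
  rw [Measure.lintegral_compProd hfext, lintegral_map hfext (by fun_prop),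
    ← Kernel.traj_map_frestrictLe_apply, lintegral_map hinner (by fun_prop)] at hmarkov
  simp only [extend_eq] at hmarkov
  exact hmarkov.symm

theorem lintegral_chain_continueConst (n : ℕ) : ∀ (x : E) {f : (ℕ → E) → ℝ≥0∞}, Measurable f →
    ∫⁻ z, f (continueConst n z (z (n + 1))) ∂chain κ x =
      ∫⁻ y, ∫⁻ z, f (continueConst n (seqCons x z) (seqCons x z (n + 1))) ∂chain κ y ∂κ x := by
  induction n with
  | zero =>
    intro x f hf
    have hf' : Measurable fun p : E × E => f (seqCons p.1 fun _ => p.2) := by fun_prop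
    rw [lintegral_chain_succ κ x 0 hf]
    simp only [continueConst_zero, seqCons]
    refine (lintegral_chain_zero κ x (hf'.lintegral_kernel_prod_right' (κ := κ))).trans ?_
    exact lintegral_congr fun y => (lintegral_chain_zero κ y (hf'.comp measurable_prodMk_left)).symm
  | succ n ih =>
    intro x f hf
    let g (w : ℕ → E) : ℝ≥0∞ := ∫⁻ e, f (continueConst (n + 1) w e) ∂κ (w (n + 1))
    have hg : Measurable g :=
      (hf.comp (measurable_continueConst (n + 1))).lintegral_kernel_prod_right'
        (κ := κ.comap (fun w : ℕ → E => w (n + 1)) (measurable_pi_apply _))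
    have hg_eq (z : ℕ → E) : g (continueConst n z (z (n + 1))) = g z := by
      simp only [g, continueConst_succ_continueConst]
      simp [continueConst]
    calc ∫⁻ z, f (continueConst (n + 1) z (z (n + 1 + 1))) ∂chain κ x
        = ∫⁻ z, g z ∂chain κ x := lintegral_chain_succ κ x (n + 1) hf
      _ = ∫⁻ y, ∫⁻ z, g (seqCons x z) ∂chain κ y ∂κ x := by simpa only [hg_eq] using ih x hg
      _ = _ := by
          refine lintegral_congr fun y => ?_
          simp only [g, continueConst_succ_seqCons, seqCons]
          exact (lintegral_chain_succ κ y n (hf.comp (measurable_seqCons_right x))).symm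

omit [MeasurableSpace E] in
theorem ext_of_map_frestrictLe {X : ℕ → Type*} [∀ n, MeasurableSpace (X n)]
    {μ ν : Measure (∀ n, X n)} [IsFiniteMeasure ν]
    (h : ∀ n, μ.map (Preorder.frestrictLe n) = ν.map (Preorder.frestrictLe n)) : μ = ν := by
  refine IsProjectiveLimit.unique (P := fun I => ν.map I.restrict) ?_ fun _ => rfl
  refine (isProjectiveLimit_nat_iff (fun I J hJ => ?_) _).2 h
  rw [Measure.map_map (Finset.measurable_restrict₂ hJ) (Finset.measurable_restrict I)]
  rfl

theorem chain_eq_map_comp (x : E) : chain κ x = ((chain κ ∘ₖ κ) x).map (seqCons x) := by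
  refine ext_of_map_frestrictLe fun n => Measure.ext_of_lintegral _ fun f hf => ?_
  have hf' : Measurable fun z : ℕ → E => f (Preorder.frestrictLe n z) := hf.comp (by fun_prop)
  have frestrictLe_continueConst (z : ℕ → E) (e : E) :
      Preorder.frestrictLe (π := fun _ => E) n (continueConst n z e) =
        Preorder.frestrictLe n z := by
    ext i; simp [continueConst, Finset.mem_Iic.1 i.2]
  have h := lintegral_chain_continueConst κ n x hf'
  simp only [frestrictLe_continueConst] at h
  rw [lintegral_map hf (by fun_prop), lintegral_map hf (by fun_prop),
    lintegral_map hf' (by fun_prop), Kernel.lintegral_comp _ _ _ (by fun_prop), h]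

theorem integral_chain (x : E) {f : (ℕ → E) → ℝ} (hf : Integrable f (chain κ x)) :
    ∫ z, f z ∂chain κ x = ∫ y, ∫ z, f (seqCons x z) ∂chain κ y ∂κ x := by
  have hcons := (measurable_seqCons_right x).aemeasurable (μ := (chain κ ∘ₖ κ) x)
  rw [chain_eq_map_comp] at hf ⊢
  rw [integral_map hcons hf.aestronglyMeasurable]
  exact Kernel.integral_comp ((integrable_map_measure hf.aestronglyMeasurable hcons).1 hf)

theorem ae_chain_zero_eq [MeasurableSingletonClass E] (x : E) : ∀ᵐ z ∂chain κ x, z 0 = x := by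
  have h : ∀ᵐ y ∂(chain κ x).map (fun z => z 0), y = x := by
    rw [map_chain_zero]
    exact (ae_dirac_iff (measurableSet_singleton x)).2 rfl
  exact ae_of_ae_map (measurable_pi_apply (X := fun _ : ℕ => E) 0).aemeasurable h

theorem ae_chain_step {p : E → E → Prop} (hp : MeasurableSet {y : E × E | p y.1 y.2})
    (h : ∀ x, ∀ᵐ y ∂κ x, p x y) (x : E) : ∀ᵐ z ∂chain κ x, ∀ n, p (z n) (z (n + 1)) := by
  refine ae_all_iff.2 fun n => ?_
  have hpn : MeasurableSet {z : ℕ → E | ¬ p (z n) (z (n + 1))} :=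
    (hp.preimage (f := fun z : ℕ → E => (z n, z (n + 1))) (by fun_prop)).compl
  have hind (z : ℕ → E) (e : E) :
      {z : ℕ → E | ¬ p (z n) (z (n + 1))}.indicator (1 : (ℕ → E) → ℝ≥0∞) (continueConst n z e) =
        {e | ¬ p (z n) e}.indicator 1 e := by
    have hpre : continueConst n z ⁻¹' {z | ¬ p (z n) (z (n + 1))} = {e | ¬ p (z n) e} := by
      ext e
      simp [continueConst]
    rw [← hpre]
    rfl
  have hnull (y : E) : ∫⁻ e, {e | ¬ p y e}.indicator 1 e ∂κ y = 0 := by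
    have hpy : MeasurableSet {e | ¬ p y e} := hp.compl.preimage measurable_prodMk_left
    rw [lintegral_indicator_one hpy]
    exact h y
  have hstep := lintegral_chain_succ κ x n (measurable_one.indicator hpn)
  simp only [hind, hnull, lintegral_zero] at hstep
  rw [ae_iff, ← lintegral_indicator_one hpn]
  exact hstep

/-- A rule for stopping a chain at random: an arrival at `y` stops the chain with probability
`prob y`, and stops it within a target with probability `hit y`. -/
structure StopRule (E : Type*) [MeasurableSpace E] where
  prob : E → ℝ
  hit : E → ℝ
  measurable_prob : Measurable prob
  measurable_hit : Measurable hit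
  hit_nonneg : ∀ y, 0 ≤ hit y
  hit_le_prob : ∀ y, hit y ≤ prob y
  prob_le_one : ∀ y, prob y ≤ 1

/-- Bounded rewards and discounts of the steps of a chain.  As null sets of steps do not matter,
the bounds hold almost surely only. -/
structure StepReward (κ : Kernel E E) where
  reward : E → E → ℝ
  discount : E → E → ℝ
  bound : ℝ
  measurable_reward : Measurable (Function.uncurry reward)
  measurable_discount : Measurable (Function.uncurry discount)
  ae_abs_reward_le : ∀ x, ∀ᵐ y ∂κ x, |reward x y| ≤ bound
  ae_abs_discount_le : ∀ x, ∀ᵐ y ∂κ x, |discount x y| ≤ 1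

/-- The probability that the trajectory `z` is stopped at time `n + 1` within the target. -/
def StopRule.weight (σ : StopRule E) (n : ℕ) (z : ℕ → E) : ℝ :=
  (∏ i ∈ Finset.range n, (1 - σ.prob (z (i + 1)))) * σ.hit (z (n + 1))

/-- The discounted reward collected by the trajectory `z` in its first `n` steps. -/
def StepReward.total {κ : Kernel E E} (ρ : StepReward κ) (n : ℕ) (z : ℕ → E) : ℝ :=
  ∑ k ∈ Finset.range n,
    (∏ m ∈ Finset.range k, ρ.discount (z m) (z (m + 1))) * ρ.reward (z k) (z (k + 1))

/-- The probability that the chain started at `x` is stopped at time `n + 1` within the target. -/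
def stopMass (σ : StopRule E) (n : ℕ) (x : E) : ℝ := ∫ z, σ.weight n z ∂chain κ x

variable {κ} in
/-- The expected reward of the chain started at `x` on the event that it is stopped at time `n + 1`
within the target. -/
def stopReward (σ : StopRule E) (ρ : StepReward κ) (n : ℕ) (x : E) : ℝ :=
  ∫ z, σ.weight n z * ρ.total (n + 1) z ∂chain κ x

namespace StopRule

variable (σ : StopRule E) (n : ℕ) (x : E) (z : ℕ → E)

theorem weight_zero : σ.weight 0 z = σ.hit (z 1) := by simp [weight]

theorem weight_succ_seqCons :
    σ.weight (n + 1) (seqCons x z) = (1 - σ.prob (z 0)) * σ.weight n z := by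
  simp only [weight, seqCons, Finset.prod_range_succ']
  ring

theorem weight_nonneg : 0 ≤ σ.weight n z :=
  mul_nonneg (Finset.prod_nonneg fun _ _ => sub_nonneg.2 (σ.prob_le_one _)) (σ.hit_nonneg _)

theorem weight_le_one : σ.weight n z ≤ 1 :=
  mul_le_one₀ (Finset.prod_le_one (fun _ _ => sub_nonneg.2 (σ.prob_le_one _)) fun _ _ =>
    sub_le_self 1 ((σ.hit_nonneg _).trans (σ.hit_le_prob _))) (σ.hit_nonneg _)
    ((σ.hit_le_prob _).trans (σ.prob_le_one _))

theorem measurable_weight : Measurable (σ.weight n) := by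
  have := σ.measurable_prob
  have := σ.measurable_hit
  unfold weight
  fun_prop

theorem integrable_weight : Integrable (σ.weight n) (chain κ x) :=
  .of_bound (σ.measurable_weight n).aestronglyMeasurable 1 <| .of_forall fun z => by
    rw [Real.norm_of_nonneg (σ.weight_nonneg n z)]
    exact σ.weight_le_one n z

end StopRule

namespace StepReward

variable {κ} (ρ : StepReward κ) (n : ℕ) (x : E)

omit [IsMarkovKernel κ] in
theorem total_succ_seqCons (z : ℕ → E) :
    ρ.total (n + 1) (seqCons x z) = ρ.reward x (z 0) + ρ.discount x (z 0) * ρ.total n z := by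
  simp only [total, seqCons, Finset.sum_range_succ', Finset.prod_range_succ',
    Finset.prod_range_zero, one_mul, Finset.mul_sum]
  rw [add_comm]
  exact congrArg _ (Finset.sum_congr rfl fun _ _ => by ring)

omit [IsMarkovKernel κ] in
theorem measurable_total : Measurable (ρ.total n) := by
  have hstep {F : E → E → ℝ} (hF : Measurable (Function.uncurry F)) (k : ℕ) :
      Measurable fun z : ℕ → E => F (z k) (z (k + 1)) :=
    hF.comp (f := fun z : ℕ → E => (z k, z (k + 1))) (by fun_prop)
  exact Finset.measurable_sum _ fun k _ =>
    (Finset.measurable_prod _ fun m _ => hstep ρ.measurable_discount m).mul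
      (hstep ρ.measurable_reward k)

theorem ae_abs_total_le : ∀ᵐ z ∂chain κ x, |ρ.total n z| ≤ ρ.bound * n := by
  have measurableSet_abs_le {F : E → E → ℝ} (hF : Measurable (Function.uncurry F)) (C : ℝ) :
      MeasurableSet {y : E × E | |F y.1 y.2| ≤ C} := measurableSet_le hF.abs measurable_const
  have hreward := ae_chain_step κ (measurableSet_abs_le ρ.measurable_reward _)
    ρ.ae_abs_reward_le x
  have hdiscount := ae_chain_step κ (measurableSet_abs_le ρ.measurable_discount _)
    ρ.ae_abs_discount_le x
  filter_upwards [hreward, hdiscount] with z hr hd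
  calc |ρ.total n z| ≤ ∑ _ ∈ Finset.range n, ρ.bound := by
        refine (Finset.abs_sum_le_sum_abs _ _).trans (Finset.sum_le_sum fun k _ => ?_)
        rw [abs_mul, Finset.abs_prod]
        exact (mul_le_of_le_one_left (abs_nonneg _)
          (Finset.prod_le_one (fun _ _ => abs_nonneg _) fun m _ => hd m)).trans (hr k)
    _ = ρ.bound * n := by rw [Finset.sum_const, Finset.card_range, nsmul_eq_mul, mul_comm]

theorem integrable_total : Integrable (ρ.total n) (chain κ x) :=
  .of_bound (ρ.measurable_total n).aestronglyMeasurable _ (ρ.ae_abs_total_le n x)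

variable (σ : StopRule E)

theorem ae_abs_weight_mul_total_le :
    ∀ᵐ z ∂chain κ x, |σ.weight n z * ρ.total (n + 1) z| ≤ ρ.bound * (n + 1) * σ.weight n z := by
  filter_upwards [ρ.ae_abs_total_le (n + 1) x] with z hz
  rw [abs_mul, abs_of_nonneg (σ.weight_nonneg n z), mul_comm]
  exact mul_le_mul_of_nonneg_right (mod_cast hz) (σ.weight_nonneg n z)

theorem integrable_weight_mul_total :
    Integrable (fun z => σ.weight n z * ρ.total (n + 1) z) (chain κ x) :=
  ((σ.integrable_weight κ n x).const_mul (ρ.bound * (n + 1))).mono'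
    ((σ.measurable_weight n).mul (ρ.measurable_total _)).aestronglyMeasurable
    (ρ.ae_abs_weight_mul_total_le n x σ)

theorem integral_abs_weight_mul_total_le :
    ∫ z, |σ.weight n z * ρ.total (n + 1) z| ∂chain κ x ≤
      ρ.bound * (n + 1) * stopMass κ σ n x := by
  rw [stopMass, ← integral_const_mul]
  exact integral_mono_ae (ρ.integrable_weight_mul_total n x σ).abs
    ((σ.integrable_weight κ n x).const_mul _) (ρ.ae_abs_weight_mul_total_le n x σ)

end StepReward

section FirstStep

variable (σ : StopRule E) (n : ℕ) (x : E)

theorem stopMass_nonneg : 0 ≤ stopMass κ σ n x := integral_nonneg (σ.weight_nonneg n)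

variable [MeasurableSingletonClass E]

theorem integral_chain_congr_zero (F : E → (ℕ → E) → ℝ) :
    ∫ z, F (z 0) z ∂chain κ x = ∫ z, F x z ∂chain κ x :=
  integral_congr_ae <| (ae_chain_zero_eq κ x).mono fun z hz => by simp only [hz]

theorem stopMass_zero : stopMass κ σ 0 x = ∫ y, σ.hit y ∂κ x := by
  rw [stopMass, integral_chain κ x (σ.integrable_weight κ 0 x)]
  refine integral_congr_ae (.of_forall fun y => ?_)
  simp only [σ.weight_zero, seqCons]
  rw [integral_chain_congr_zero κ y fun y _ => σ.hit y]
  simp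

theorem stopMass_succ :
    stopMass κ σ (n + 1) x = ∫ y, (1 - σ.prob y) * stopMass κ σ n y ∂κ x := by
  rw [stopMass, integral_chain κ x (σ.integrable_weight κ (n + 1) x)]
  refine integral_congr_ae (.of_forall fun y => ?_)
  simp only [σ.weight_succ_seqCons]
  rw [integral_chain_congr_zero κ y fun y z => (1 - σ.prob y) * σ.weight n z, integral_const_mul]
  rfl

variable {κ} (ρ : StepReward κ)

theorem stopReward_zero : stopReward σ ρ 0 x = ∫ y, σ.hit y * ρ.reward x y ∂κ x := by
  rw [stopReward, integral_chain κ x (ρ.integrable_weight_mul_total 0 x σ)]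
  refine integral_congr_ae (.of_forall fun y => ?_)
  simp only [σ.weight_zero, ρ.total_succ_seqCons, seqCons]
  rw [integral_chain_congr_zero κ y fun y z =>
    σ.hit y * (ρ.reward x y + ρ.discount x y * ρ.total 0 z)]
  simp [StepReward.total]

theorem stopReward_succ :
    stopReward σ ρ (n + 1) x = ∫ y, (1 - σ.prob y) *
      (ρ.reward x y * stopMass κ σ n y + ρ.discount x y * stopReward σ ρ n y) ∂κ x := by
  rw [stopReward, integral_chain κ x (ρ.integrable_weight_mul_total (n + 1) x σ)]
  refine integral_congr_ae (.of_forall fun y => ?_)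
  simp only [σ.weight_succ_seqCons, ρ.total_succ_seqCons]
  rw [integral_chain_congr_zero κ y fun y z => (1 - σ.prob y) * σ.weight n z *
    (ρ.reward x y + ρ.discount x y * ρ.total (n + 1) z), stopMass, stopReward,
    ← integral_const_mul, ← integral_const_mul,
    ← integral_add ((σ.integrable_weight κ n y).const_mul _)
      ((ρ.integrable_weight_mul_total n y σ).const_mul _), ← integral_const_mul]
  exact integral_congr_ae (.of_forall fun z => by ring)

end FirstStep

end Chain

section NonnegMatrix

open Filter Topology

theorem summable_succ_mul_sub {T : ℕ → ℝ} (hnonneg : ∀ n, 0 ≤ T n) (hanti : Antitone T)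
    (hT : Summable T) : Summable fun n : ℕ => (n + 1) * (T n - T (n + 1)) := by
  have abel (N : ℕ) : ∑ n ∈ Finset.range N, (n + 1) * (T n - T (n + 1)) =
      ∑ n ∈ Finset.range N, T n - N * T N := by
    induction N with
    | zero => simp
    | succ N ih => rw [Finset.sum_range_succ, Finset.sum_range_succ, ih]; push_cast; ring
  refine summable_of_sum_range_le (c := ∑' n, T n)
    (fun n => mul_nonneg (by positivity) (sub_nonneg.2 (hanti n.le_succ))) fun N => ?_
  rw [abel]
  exact (sub_le_self _ (mul_nonneg N.cast_nonneg (hnonneg N))).trans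
    (hT.sum_le_tsum _ fun n _ => hnonneg n)

variable {ι : Type*} [Fintype ι]

theorem hasSum_mulVec {ι' : Type*} (B : Matrix ι' ι ℝ) {u : ℕ → ι → ℝ} {U : ι → ℝ}
    (hU : HasSum u U) : HasSum (fun n => B *ᵥ u n) (B *ᵥ U) :=
  hU.map B.mulVecLin B.mulVecLin.continuous_of_finiteDimensional

theorem mulVec_mono {B : Matrix ι ι ℝ} (hB : ∀ i j, 0 ≤ B i j) : Monotone fun v => B *ᵥ v :=
  fun _ _ h i => dotProduct_le_dotProduct_of_nonneg_left h (hB i)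

theorem abs_mulVec_le {ι' : Type*} {A B : Matrix ι' ι ℝ} (hAB : ∀ i j, |A i j| ≤ B i j)
    (v : ι → ℝ) (i : ι') : |(A *ᵥ v) i| ≤ (B *ᵥ |v|) i := by
  refine (Finset.abs_sum_le_sum_abs _ _).trans (Finset.sum_le_sum fun j _ => ?_)
  rw [abs_mul, Pi.abs_apply]
  exact mul_le_mul_of_nonneg_right (hAB i j) (abs_nonneg _)

variable [DecidableEq ι] {B : Matrix ι ι ℝ}

theorem pow_mulVec_mono (hB : ∀ i j, 0 ≤ B i j) (n : ℕ) : Monotone fun v => B ^ n *ᵥ v :=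
  mulVec_mono (Matrix.pow_apply_nonneg hB n)

theorem pow_mulVec_nonneg (hB : ∀ i j, 0 ≤ B i j) (n : ℕ) {v : ι → ℝ} (hv : 0 ≤ v) :
    0 ≤ B ^ n *ᵥ v := by
  simpa using pow_mulVec_mono hB n hv

theorem pow_mulVec_antitone (hB : ∀ i j, 0 ≤ B i j) {v : ι → ℝ} (hv : B *ᵥ v ≤ v) :
    Antitone fun n => B ^ n *ᵥ v :=
  antitone_nat_of_succ_le fun n => by
    rw [pow_succ, ← Matrix.mulVec_mulVec]
    exact pow_mulVec_mono hB n hv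

theorem diagonal_inv_mulVec {d : ι → ℝ} (hd : ∀ i, d i ≠ 0) (v : ι → ℝ) (i : ι) :
    ((Matrix.diagonal d)⁻¹ *ᵥ v) i = (d i)⁻¹ * v i := by
  have hinv : (Matrix.diagonal d)⁻¹ = Matrix.diagonal fun i => (d i)⁻¹ :=
    Matrix.inv_eq_right_inv <| by
      rw [Matrix.diagonal_mul_diagonal, ← Matrix.diagonal_one]
      exact congrArg _ (funext fun i => mul_inv_cancel₀ (hd i))
  rw [hinv, Matrix.mulVec_diagonal]

theorem eq_add_mulVec_of_hasSum {b U : ι → ℝ} (hU : HasSum (fun n => B ^ n *ᵥ b) U) :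
    U = b + B *ᵥ U := by
  have hsucc := hasSum_mulVec B hU
  simp only [Matrix.mulVec_mulVec, ← pow_succ'] at hsucc
  simpa using hU.unique hsucc.zero_add

theorem pow_mulVec_eq_sub {b U : ι → ℝ} (hU : U = b + B *ᵥ U) (n : ℕ) :
    B ^ n *ᵥ b = B ^ n *ᵥ U - B ^ (n + 1) *ᵥ U := by
  rw [pow_succ, ← Matrix.mulVec_mulVec, ← Matrix.mulVec_sub, sub_eq_of_eq_add hU]

theorem tendsto_pow_mulVec_of_hasSum {b U : ι → ℝ} (hU : HasSum (fun n => B ^ n *ᵥ b) U) :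
    Tendsto (fun n => B ^ n *ᵥ U) atTop (𝓝 0) := by
  have htail (n : ℕ) : U - ∑ k ∈ Finset.range n, B ^ k *ᵥ b = B ^ n *ᵥ U := by
    simp only [pow_mulVec_eq_sub (eq_add_mulVec_of_hasSum hU),
      Finset.sum_range_sub' fun k => B ^ k *ᵥ U, pow_zero, Matrix.one_mulVec, sub_sub_cancel]
  have h := hU.tendsto_sum_nat.const_sub U
  rwa [sub_self, funext htail] at h

theorem exists_pow_mulVec_le_half_smul (hB : ∀ i j, 0 ≤ B i j) {v : ι → ℝ} (hv : 0 ≤ v)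
    (hBv : B *ᵥ v ≤ v) (hlim : Tendsto (fun n => B ^ n *ᵥ v) atTop (𝓝 0)) :
    ∃ k, B ^ k *ᵥ v ≤ (1 / 2 : ℝ) • v := by
  have hcoord (i : ι) : ∀ᶠ n in atTop, (B ^ n *ᵥ v) i ≤ 1 / 2 * v i := by
    rcases (hv i).eq_or_lt with h | h
    · refine .of_forall fun n => ?_
      simpa [← h] using pow_mulVec_antitone hB hBv n.zero_le i
    · exact (tendsto_pi_nhds.1 hlim i).eventually_le_const (by simpa using h)
  exact (eventually_all.2 hcoord).exists

theorem summable_pow_mulVec (hB : ∀ i j, 0 ≤ B i j) {v : ι → ℝ} (hv : 0 ≤ v) (hBv : B *ᵥ v ≤ v)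
    (hlim : Tendsto (fun n => B ^ n *ᵥ v) atTop (𝓝 0)) (i : ι) :
    Summable fun n => (B ^ n *ᵥ v) i := by
  obtain ⟨k, hk⟩ := exists_pow_mulVec_le_half_smul hB hv hBv hlim
  have hnonneg (n : ℕ) : 0 ≤ (B ^ n *ᵥ v) i := pow_mulVec_nonneg hB n hv i
  have hhalf (n : ℕ) : (B ^ (k + n) *ᵥ v) i ≤ 1 / 2 * (B ^ n *ᵥ v) i := by
    rw [add_comm, pow_add, ← Matrix.mulVec_mulVec]
    simpa [Matrix.mulVec_smul] using pow_mulVec_mono hB n hk i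
  refine summable_of_sum_range_le (c := 2 * ∑ n ∈ Finset.range k, (B ^ n *ᵥ v) i) hnonneg
    fun N => ?_
  have hmore : ∑ n ∈ Finset.range N, (B ^ n *ᵥ v) i ≤ ∑ n ∈ Finset.range (k + N), (B ^ n *ᵥ v) i :=
    Finset.sum_le_sum_of_subset_of_nonneg (Finset.range_mono (N.le_add_left k))
      fun n _ _ => hnonneg n
  have htail := Finset.sum_le_sum fun n (_ : n ∈ Finset.range N) => hhalf n
  rw [Finset.sum_range_add] at hmore
  rw [← Finset.mul_sum] at htail
  linarith

theorem summable_succ_mul_pow_mulVec (hB : ∀ i j, 0 ≤ B i j) {b U : ι → ℝ} (hb : 0 ≤ b)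
    (hU : HasSum (fun n => B ^ n *ᵥ b) U) (i : ι) :
    Summable fun n : ℕ => (n + 1) * (B ^ n *ᵥ b) i := by
  have hU_eq := eq_add_mulVec_of_hasSum hU
  have hBU : B *ᵥ U ≤ U := (le_add_of_nonneg_left hb).trans_eq hU_eq.symm
  have hU_nonneg : 0 ≤ U := hU.nonneg fun n => pow_mulVec_nonneg hB n hb
  simp only [pow_mulVec_eq_sub hU_eq, Pi.sub_apply]
  exact summable_succ_mul_sub (fun n => pow_mulVec_nonneg hB n hU_nonneg i)
    (fun _ _ h => pow_mulVec_antitone hB hBU h i)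
    (summable_pow_mulVec hB hU_nonneg hBU (tendsto_pow_mulVec_of_hasSum hU) i)

theorem eq_zero_of_abs_le_mulVec_abs (hB : ∀ i j, 0 ≤ B i j) {D U : ι → ℝ} {C : ℝ}
    (hlim : Tendsto (fun n => B ^ n *ᵥ U) atTop (𝓝 0)) (hDU : |D| ≤ C • U)
    (hD : |D| ≤ B *ᵥ |D|) : D = 0 := by
  have hpow (n : ℕ) : |D| ≤ B ^ n *ᵥ |D| := by
    induction n with
    | zero => simp
    | succ n ih =>
      rw [pow_succ, ← Matrix.mulVec_mulVec]
      exact ih.trans (pow_mulVec_mono hB n hD)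
  have hle : |D| ≤ C • (0 : ι → ℝ) := ge_of_tendsto' (hlim.const_smul C) fun n =>
    (hpow n).trans ((pow_mulVec_mono hB n hDU).trans_eq (Matrix.mulVec_smul _ _ _))
  rw [smul_zero] at hle
  exact funext fun i => abs_nonpos_iff.1 (hle i)

end NonnegMatrix

section Geometric

variable {q : ℝ}

theorem geoMeasure_apply (hq : q ≠ 0) (B : Set ℕ∞) :
    geoMeasure q B =
      ∑' k : ℕ, ENNReal.ofReal ((1 - q) ^ k * q) * B.indicator 1 ((k + 1 : ℕ) : ℕ∞) := by
  rw [geoMeasure, if_neg hq, Measure.sum_apply _ .of_discrete]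
  simp

theorem hasSum_geometric_tail (hq : 0 < q) (hq1 : q ≤ 1) (n : ℕ) :
    HasSum (fun k => if n ≤ k then (1 - q) ^ k * q else 0) ((1 - q) ^ n) := by
  have hgeom := ((hasSum_geometric_of_lt_one (sub_nonneg.2 hq1) (sub_lt_self 1 hq)).mul_right
    q).mul_left ((1 - q) ^ n)
  rw [sub_sub_cancel, inv_mul_cancel₀ hq.ne', mul_one] at hgeom
  rw [← hasSum_nat_add_iff' n, Finset.sum_eq_zero fun k hk => if_neg (Finset.mem_range.1 hk).not_ge,
    sub_zero]
  simpa [pow_add, mul_assoc, mul_left_comm] using hgeom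

theorem geoMeasure_Ioi (hq : 0 ≤ q) (hq1 : q ≤ 1) (n : ℕ) :
    geoMeasure q (Set.Ioi n) = ENNReal.ofReal ((1 - q) ^ n) := by
  rcases hq.eq_or_lt with rfl | hq
  · simp [geoMeasure]
  have hterm (k : ℕ) : ENNReal.ofReal ((1 - q) ^ k * q) *
      (Set.Ioi (n : ℕ∞)).indicator 1 ((k + 1 : ℕ) : ℕ∞) =
        ENNReal.ofReal (if n ≤ k then (1 - q) ^ k * q else 0) := by
    have hmem : ((k + 1 : ℕ) : ℕ∞) ∈ Set.Ioi (n : ℕ∞) ↔ n ≤ k := by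
      rw [Set.mem_Ioi, Nat.cast_lt, Nat.lt_succ_iff]
    by_cases h : n ≤ k
    · rw [Set.indicator_of_mem (hmem.2 h), if_pos h, Pi.one_apply, mul_one]
    · rw [Set.indicator_of_notMem (hmem.not.2 h), if_neg h, mul_zero, ENNReal.ofReal_zero]
  have hsum := hasSum_geometric_tail hq hq1 n
  rw [geoMeasure_apply hq.ne', tsum_congr hterm, ← hsum.tsum_eq,
    ENNReal.ofReal_tsum_of_nonneg (fun k => ?_) hsum.summable]
  split_ifs
  · exact mul_nonneg (pow_nonneg (sub_nonneg.2 hq1) k) hq.le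
  · exact le_rfl

theorem isProbabilityMeasure_geoMeasure (hq : 0 ≤ q) (hq1 : q ≤ 1) :
    IsProbabilityMeasure (geoMeasure q) := by
  have huniv : geoMeasure q Set.univ = geoMeasure q (Set.Ioi (0 : ℕ)) := by
    by_cases h : q = 0
    · simp [geoMeasure, h]
    · simp [geoMeasure_apply h, Set.indicator]
  exact ⟨by rw [huniv, geoMeasure_Ioi hq hq1]; simp⟩

end Geometric

section StoppingTime

instance : BorelSpace ℕ∞ := ⟨borel_eq_top_of_countable.symm⟩

variable {S A : Type*}

instance [Finite S] [Finite A] : Finite (Obs S A) :=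
  .of_injective (fun x => (x.action, x.state)) fun _ _ h =>
    Obs.ext (congrArg Prod.fst h) (congrArg Prod.snd h)

theorem measurableSet_trajectory_mem (n : ℕ) (B : Set (Obs S A)) :
    MeasurableSet {z : ℕ → Obs S A | z n ∈ B} :=
  (MeasurableSet.of_discrete (s := B)).preimage (measurable_pi_apply n)

variable [Fintype S] [DecidableEq S] [Fintype A] {K : ℕ} {Factor : Fin K → Type*}
  (M : MDP S A K Factor)

/-- The record was produced by an ending action. -/
def Obs.IsEnd (x : Obs S A) : Prop := ∃ a, x.action = some a ∧ M.IsEnd a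

theorem natCast_lt_firstEnd_iff (n : ℕ) (z : ℕ → Obs S A) :
    (n : ℕ∞) < firstEnd M z ↔ ∀ i ≤ n, ¬ (z i).IsEnd M := by
  rw [← ENat.add_one_le_iff (ENat.natCast_ne_top n), ← Nat.cast_add_one]
  simp only [firstEnd, le_iInf_iff, Nat.cast_le, Nat.succ_le_iff]
  exact forall_congr' fun i =>
    ⟨fun h hi hz => (h hz).not_ge hi, fun h hz => not_le.1 fun hi => h hi hz⟩

theorem measurable_firstEnd : Measurable (firstEnd M) := by
  refine measurable_of_Ioi fun c => ?_
  induction c with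
  | top => simp
  | coe n =>
    have : firstEnd M ⁻¹' Set.Ioi n = ⋂ i, ⋂ (_ : i ≤ n), {z | z i ∈ {x | ¬ x.IsEnd M}} := by
      ext z
      simp [natCast_lt_firstEnd_iff]
    rw [this]
    exact .iInter fun i => .iInter fun _ => measurableSet_trajectory_mem i _

theorem measurable_stopTime : Measurable (stopTime M) :=
  measurable_snd.min ((measurable_firstEnd M).comp measurable_fst)

open Classical in
/-- The probability that a run with stopping probability `q` per step stops at the record `x`. -/
def haltProb (q : ℝ) (x : Obs S A) : ℝ := if x.IsEnd M then 1 else q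

variable {q : ℝ}

theorem haltProb_le_one (hq : q ≤ 1) (x : Obs S A) : haltProb M q x ≤ 1 := by
  unfold haltProb
  split_ifs
  · exact le_rfl
  · exact hq

theorem prod_one_sub_haltProb (z : ℕ → Obs S A) (hz : ¬ (z 0).IsEnd M) (n : ℕ)
    [Decidable ((n : ℕ∞) < firstEnd M z)] :
    ∏ i ∈ Finset.range n, (1 - haltProb M q (z (i + 1))) =
      if (n : ℕ∞) < firstEnd M z then (1 - q) ^ n else 0 := by
  classical
  have hfactor (i : ℕ) : 1 - haltProb M q (z (i + 1)) =
      if ¬ (z (i + 1)).IsEnd M then 1 - q else 0 := by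
    unfold haltProb
    split_ifs <;> simp_all
  have hiff : (∀ i ∈ Finset.range n, ¬ (z (i + 1)).IsEnd M) ↔ (n : ℕ∞) < firstEnd M z := by
    rw [natCast_lt_firstEnd_iff]
    refine ⟨fun h i hi => ?_, fun h i hi => h (i + 1) (Finset.mem_range.1 hi)⟩
    cases i with
    | zero => exact hz
    | succ i => exact h i (Finset.mem_range.2 hi)
  simp only [hfactor, Finset.prod_ite_zero, Finset.prod_const, Finset.card_range, hiff]

variable (hq : 0 ≤ q) (hq1 : q ≤ 1)
include hq hq1

theorem geoMeasure_lt_stopTime (z : ℕ → Obs S A) (hz : ¬ (z 0).IsEnd M) (n : ℕ) :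
    (geoMeasure q).real {g | (n : ℕ∞) < stopTime M (z, g)} =
      ∏ i ∈ Finset.range n, (1 - haltProb M q (z (i + 1))) := by
  classical
  rw [prod_one_sub_haltProb M z hz]
  split_ifs with h
  · have hset : {g | (n : ℕ∞) < stopTime M (z, g)} = Set.Ioi (n : ℕ∞) := by
      ext g; simp [stopTime, h]
    rw [hset, measureReal_def, geoMeasure_Ioi hq hq1,
      ENNReal.toReal_ofReal (pow_nonneg (sub_nonneg.2 hq1) n)]
  · simp [stopTime, h]

theorem geoMeasure_stopTime_eq_zero (z : ℕ → Obs S A) (hz : ¬ (z 0).IsEnd M) :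
    (geoMeasure q).real {g | stopTime M (z, g) = 0} = 0 := by
  have := isProbabilityMeasure_geoMeasure hq hq1
  have hpos := geoMeasure_lt_stopTime M hq hq1 z hz 0
  have hcompl : {g | stopTime M (z, g) = 0} = {g | ((0 : ℕ) : ℕ∞) < stopTime M (z, g)}ᶜ := by
    ext g; simp
  rw [hcompl, probReal_compl_eq_one_sub .of_discrete, hpos]
  simp

theorem geoMeasure_stopTime_eq_succ (z : ℕ → Obs S A) (hz : ¬ (z 0).IsEnd M) (n : ℕ) :
    (geoMeasure q).real {g | stopTime M (z, g) = (n + 1 : ℕ)} =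
      (∏ i ∈ Finset.range n, (1 - haltProb M q (z (i + 1)))) * haltProb M q (z (n + 1)) := by
  have := isProbabilityMeasure_geoMeasure hq hq1
  have hdiff : {g | stopTime M (z, g) = (n + 1 : ℕ)} =
      {g | (n : ℕ∞) < stopTime M (z, g)} \ {g | ((n + 1 : ℕ) : ℕ∞) < stopTime M (z, g)} := by
    ext g
    simp only [Set.mem_ofPred_eq, Set.mem_sdiff]
    induction stopTime M (z, g) with
    | top => simpa using (ENat.top_ne_natCast (n + 1))
    | coe m => norm_cast; lia
  have hsub : {g | ((n + 1 : ℕ) : ℕ∞) < stopTime M (z, g)} ⊆ {g | (n : ℕ∞) < stopTime M (z, g)} :=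
    Set.ofPred_subset_ofPred.2 fun g => (Nat.cast_lt.2 n.lt_succ_self).trans
  rw [hdiff, measureReal_sdiff hsub .of_discrete, geoMeasure_lt_stopTime M hq hq1 z hz,
    geoMeasure_lt_stopTime M hq hq1 z hz, Finset.prod_range_succ]
  ring

end StoppingTime

section Run

variable {S A : Type*} [Fintype S] [DecidableEq S] [Fintype A] {K : ℕ} {Factor : Fin K → Type*}
  (M : MDP S A K Factor) (π : Policy M)

theorem stepKernel_of_state_eq_none {x : Obs S A} (hx : x.state = none) :
    stepKernel M π x = .dirac ⟨none, none⟩ := by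
  change stepMeasure M π x = _
  rw [stepMeasure, hx]

theorem stepKernel_of_state_eq_some {x : Obs S A} {s : S} (hx : x.state = some s) :
    stepKernel M π x = ∑ a ∈ M.avail s, ENNReal.ofReal (π.prob s a) •
      (∑ s'', ENNReal.ofReal (M.P s a s'') • Measure.dirac ⟨some a, some s''⟩
        + ENNReal.ofReal (1 - ∑ s'', M.P s a s'') • Measure.dirac ⟨some a, none⟩) := by
  change stepMeasure M π x = _
  rw [stepMeasure, hx]

theorem ae_stepKernel {x : Obs S A} {s : S} (hx : x.state = some s) {p : Obs S A → Prop}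
    (hp : ∀ a ∈ M.avail s, ∀ s'', 0 < M.P s a s'' → p ⟨some a, some s''⟩)
    (hlost : ∀ a, p ⟨some a, none⟩) : ∀ᵐ y ∂stepKernel M π x, p y := by
  have hmoved : ∀ a ∈ M.avail s, ∀ s'', ENNReal.ofReal (M.P s a s'') *
      Measure.dirac (⟨some a, some s''⟩ : Obs S A) {y | ¬ p y} = 0 := fun a ha s'' => by
    rcases le_or_gt (M.P s a s'') 0 with h | h
    · rw [ENNReal.ofReal_of_nonpos h, zero_mul]
    · simp [hp a ha s'' h]
  rw [ae_iff, stepKernel_of_state_eq_some M π hx]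
  simp only [Measure.coe_finsetSum, Finset.sum_apply, Measure.smul_apply, Measure.add_apply,
    smul_eq_mul]
  refine Finset.sum_eq_zero fun a ha => ?_
  rw [Finset.sum_eq_zero fun s'' _ => hmoved a ha s'']
  simp [hlost]

theorem integral_stepKernel {x : Obs S A} {s : S} (hx : x.state = some s) {g : Obs S A → ℝ}
    (hlost : ∀ a, g ⟨some a, none⟩ = 0) :
    ∫ y, g y ∂stepKernel M π x =
      ∑ s'', ∑ a ∈ M.avail s, M.P s a s'' * π.prob s a * g ⟨some a, some s''⟩ := by
  have hdirac (c : ℝ) (y : Obs S A) : Integrable g (ENNReal.ofReal c • .dirac y) :=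
    Integrable.of_finite.smul_measure ENNReal.ofReal_ne_top
  have hmoved (a : A) :
      Integrable g (∑ s'', ENNReal.ofReal (M.P s a s'') • .dirac ⟨some a, some s''⟩) :=
    integrable_finsetSum_measure.2 fun _ _ => hdirac _ _
  rw [stepKernel_of_state_eq_some M π hx, integral_finsetSum_measure fun a _ =>
    ((hmoved a).add_measure (hdirac _ _)).smul_measure ENNReal.ofReal_ne_top, Finset.sum_comm]
  refine Finset.sum_congr rfl fun a ha => ?_
  rw [integral_smul_measure, integral_add_measure (hmoved a) (hdirac _ _),
    integral_finsetSum_measure fun _ _ => hdirac _ _, ENNReal.toReal_ofReal (π.nonneg s a ha)]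
  simp only [integral_smul_measure, integral_dirac, hlost, smul_eq_mul, mul_zero, add_zero,
    ENNReal.toReal_ofReal (M.P_nonneg s a ha _), Finset.mul_sum]
  exact Finset.sum_congr rfl fun s'' _ => by ring

/-- The value of a function of triples at the transition from the record `x` to the record `y`. -/
def stepValue (F : S → A → S → ℝ) (x y : Obs S A) : ℝ :=
  match x.state, y.action, y.state with
  | some s, some a, some s'' => F s a s''
  | _, _, _ => 0

omit [DecidableEq S] in
theorem abs_stepValue_le (F : S → A → S → ℝ) (x y : Obs S A) :
    |stepValue F x y| ≤ ∑ s, ∑ a, ∑ s'', |F s a s''| := by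
  have hterm (s : S) (a : A) (s'' : S) : |F s a s''| ≤ ∑ s, ∑ a, ∑ s'', |F s a s''| := by
    simp only [← Fintype.sum_prod_type']
    exact Finset.single_le_sum (f := fun p : S × A × S => |F p.1 p.2.1 p.2.2|)
      (fun _ _ => abs_nonneg _) (Finset.mem_univ (s, a, s''))
  unfold stepValue
  split
  · exact hterm _ _ _
  · rw [abs_zero]; positivity

theorem ae_abs_stepValue_discount_le (x : Obs S A) :
    ∀ᵐ y ∂stepKernel M π x, |stepValue M.Γ x y| ≤ 1 := by
  rcases hx : x.state with _ | s
  · exact .of_forall fun y => by simp [stepValue, hx]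
  · refine ae_stepKernel M π hx (fun a ha s'' hP => ?_) fun a => by simp [stepValue]
    simpa only [stepValue, hx, abs_of_nonneg (M.Γ_nonneg s a ha s'' hP)]
      using M.Γ_le_one s a ha s'' hP

/-- The rewards and discounts of an MDP, as those of the chain of its records. -/
def stepReward : StepReward (stepKernel M π) where
  reward := stepValue M.R
  discount := stepValue M.Γ
  bound := ∑ s, ∑ a, ∑ s'', |M.R s a s''|
  measurable_reward := .of_discrete
  measurable_discount := .of_discrete
  ae_abs_reward_le x := .of_forall (abs_stepValue_le M.R x)
  ae_abs_discount_le := ae_abs_stepValue_discount_le M π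

theorem cumReward_zero (z : ℕ → Obs S A) (n : ℕ) :
    cumReward M z 0 n = (stepReward M π).total n z := by
  rw [cumReward, StepReward.total, Finset.range_eq_Ico]
  exact Finset.sum_congr rfl fun k _ => by rw [Finset.range_eq_Ico]; rfl

theorem stopProb_nonneg (t : ℝ≥0∞) : 0 ≤ stopProb t := ENNReal.toReal_nonneg

variable {t : ℝ≥0∞} (ht : 1 ≤ t) (s' : S)

include ht in
theorem stopProb_le_one : stopProb t ≤ 1 :=
  ENNReal.toReal_le_of_le_ofReal zero_le_one (by simpa using ht)

/-- The rule stopping the run of timescale `t`, with target state `s'`. -/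
def stopRule : StopRule (Obs S A) where
  prob := haltProb M (stopProb t)
  hit y := if y.state = some s' then haltProb M (stopProb t) y else 0
  measurable_prob := .of_discrete
  measurable_hit := .of_discrete
  hit_nonneg y := by
    have := stopProb_nonneg t
    unfold haltProb
    split_ifs <;> positivity
  hit_le_prob y := by
    have := stopProb_nonneg t
    unfold haltProb
    split_ifs <;> simp [this]
  prob_le_one := haltProb_le_one M (stopProb_le_one ht)

/-- The probability that the run from `s` stops at time `n + 1` in the state `s'`. -/
def runMass (n : ℕ) (s : S) : ℝ :=
  stopMass (stepKernel M π) (stopRule M ht s') n ⟨none, some s⟩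

/-- The expected reward of the run from `s` on the event that it stops at time `n + 1` in the state
`s'`. -/
def runReward (n : ℕ) (s : S) : ℝ :=
  stopReward (stopRule M ht s') (stepReward M π) n ⟨none, some s⟩

/-- The event `{τ = n, S_n = s'}`. -/
def stopSlice (n : ℕ) : Set ((ℕ → Obs S A) × ℕ∞) :=
  {ω | stopTime M ω = n ∧ (ω.1 n).state = some s'}

theorem stopsAt_eq_iUnion : stopsAt M s' = ⋃ n, stopSlice M s' n := by
  ext ω; simp [stopsAt, stopSlice]

theorem measurableSet_stopSlice (n : ℕ) : MeasurableSet (stopSlice M s' n) :=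
  .inter ((measurable_stopTime M) (measurableSet_singleton _))
    (measurable_fst (measurableSet_trajectory_mem n {x | x.state = some s'}))

theorem pairwise_disjoint_stopSlice : Pairwise (Function.onFun Disjoint (stopSlice M s')) :=
  fun _ _ hmn => Set.disjoint_left.2 fun _ hm hn => hmn (Nat.cast_injective (hm.1.symm.trans hn.1))

theorem stoppedReward_of_mem_stopSlice {n : ℕ} {ω : (ℕ → Obs S A) × ℕ∞}
    (h : ω ∈ stopSlice M s' n) : stoppedReward M ω = (stepReward M π).total n ω.1 := by
  rw [stoppedReward, h.1, ENat.toNat_natCast, cumReward_zero]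

instance (s : S) : IsProbabilityMeasure (trajMeasure M π s) :=
  inferInstanceAs (IsProbabilityMeasure (chain (stepKernel M π) ⟨none, some s⟩))

theorem ae_trajMeasure_not_isEnd_zero (s : S) : ∀ᵐ z ∂trajMeasure M π s, ¬ (z 0).IsEnd M :=
  (ae_chain_zero_eq (stepKernel M π) ⟨none, some s⟩).mono fun z hz => by simp [hz, Obs.IsEnd]

include ht in
theorem isProbabilityMeasure_runMeasure (s : S) : IsProbabilityMeasure (runMeasure M π t s) := by
  have := isProbabilityMeasure_geoMeasure (stopProb_nonneg t) (stopProb_le_one ht)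
  unfold runMeasure
  infer_instance

include ht in
theorem runMeasure_stopSlice_zero (s : S) : runMeasure M π t s (stopSlice M s' 0) = 0 := by
  have := isProbabilityMeasure_geoMeasure (stopProb_nonneg t) (stopProb_le_one ht)
  rw [runMeasure, Measure.measure_prod_null (measurableSet_stopSlice M s' 0)]
  filter_upwards [ae_trajMeasure_not_isEnd_zero M π s] with z hz
  refine measure_mono_null (fun g hg => hg.1) ((measureReal_eq_zero_iff (measure_ne_top _ _)).1
    (geoMeasure_stopTime_eq_zero M (stopProb_nonneg t) (stopProb_le_one ht) z hz))

theorem setIntegral_stopSlice_succ (s : S) (n : ℕ) {f : (ℕ → Obs S A) → ℝ}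
    (hf : Integrable f (trajMeasure M π s)) :
    ∫ ω in stopSlice M s' (n + 1), f ω.1 ∂runMeasure M π t s =
      ∫ z, (stopRule M ht s').weight n z * f z ∂trajMeasure M π s := by
  have := isProbabilityMeasure_geoMeasure (stopProb_nonneg t) (stopProb_le_one ht)
  have hslice := measurableSet_stopSlice M s' (n + 1)
  rw [← integral_indicator hslice, runMeasure,
    integral_prod _ ((hf.comp_fst (geoMeasure (stopProb t))).indicator hslice)]
  refine integral_congr_ae ?_
  filter_upwards [ae_trajMeasure_not_isEnd_zero M π s] with z hz
  have hsection : (fun g => (stopSlice M s' (n + 1)).indicator (fun ω => f ω.1) (z, g)) =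
      {g | stopTime M (z, g) = (n + 1 : ℕ)}.indicator
        fun _ => if (z (n + 1)).state = some s' then f z else 0 := by
    ext g
    by_cases h : stopTime M (z, g) = (n + 1 : ℕ) <;>
      simp [Set.indicator, stopSlice, h, -Nat.cast_add]
  rw [hsection, integral_indicator .of_discrete, setIntegral_const,
    geoMeasure_stopTime_eq_succ M (stopProb_nonneg t) (stopProb_le_one ht) z hz,
    StopRule.weight, smul_eq_mul]
  simp only [stopRule, mul_ite, ite_mul, mul_zero, zero_mul]

theorem hasSum_runMass (s : S) :
    HasSum (fun n => runMass M π ht s' n s) (compP M π t s s') := by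
  have := isProbabilityMeasure_runMeasure M π ht s
  have hsum := hasSum_integral_iUnion (μ := runMeasure M π t s) (f := fun _ => (1 : ℝ))
    (measurableSet_stopSlice M s') (pairwise_disjoint_stopSlice M s')
    (integrable_const _).integrableOn
  rw [← stopsAt_eq_iUnion, ← hasSum_nat_add_iff' 1] at hsum
  have hslice (n : ℕ) : ∫ _ in stopSlice M s' (n + 1), (1 : ℝ) ∂runMeasure M π t s =
      runMass M π ht s' n s := by
    rw [setIntegral_stopSlice_succ M π ht s' s n (f := fun _ => 1) (integrable_const 1)]
    simp only [mul_one]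
    rfl
  simp only [hslice] at hsum
  simpa [measureReal_def, runMeasure_stopSlice_zero M π ht, compP] using hsum

theorem setIntegral_stopSlice_stoppedReward (s : S) (n : ℕ) :
    ∫ ω in stopSlice M s' (n + 1), stoppedReward M ω ∂runMeasure M π t s =
      runReward M π ht s' n s := by
  rw [setIntegral_congr_fun (measurableSet_stopSlice M s' _)
    fun ω => stoppedReward_of_mem_stopSlice M π s',
    setIntegral_stopSlice_succ M π ht s' s n ((stepReward M π).integrable_total _ _)]
  rfl

include ht in
theorem integrableOn_stopSlice_stoppedReward (s : S) (n : ℕ) :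
    IntegrableOn (stoppedReward M) (stopSlice M s' n) (runMeasure M π t s) := by
  have := isProbabilityMeasure_geoMeasure (stopProb_nonneg t) (stopProb_le_one ht)
  refine IntegrableOn.congr_fun ?_ (fun ω hω => (stoppedReward_of_mem_stopSlice M π s' hω).symm)
    (measurableSet_stopSlice M s' n)
  exact (Integrable.comp_fst ((stepReward M π).integrable_total n ⟨none, some s⟩)
    (geoMeasure (stopProb t))).integrableOn

theorem setIntegral_stopSlice_abs_stoppedReward_le (s : S) (n : ℕ) :
    ∫ ω in stopSlice M s' (n + 1), |stoppedReward M ω| ∂runMeasure M π t s ≤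
      (stepReward M π).bound * (n + 1) * runMass M π ht s' n s := by
  rw [setIntegral_congr_fun (measurableSet_stopSlice M s' _)
    fun ω hω => congrArg abs (stoppedReward_of_mem_stopSlice M π s' hω),
    setIntegral_stopSlice_succ M π ht s' s n ((stepReward M π).integrable_total _ _).abs]
  refine le_of_eq_of_le (integral_congr_ae (.of_forall fun z => ?_))
    ((stepReward M π).integral_abs_weight_mul_total_le n ⟨none, some s⟩ (stopRule M ht s'))
  simp only [abs_mul, abs_of_nonneg (StopRule.weight_nonneg _ _ _)]

variable {s : S} (hmass : Summable fun n : ℕ =>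
  (n + 1) * runMass M π ht s' n s)
include hmass

theorem integrableOn_stopsAt_stoppedReward :
    IntegrableOn (stoppedReward M) (stopsAt M s') (runMeasure M π t s) := by
  rw [stopsAt_eq_iUnion]
  refine integrableOn_iUnion_of_summable_integral_norm
    (integrableOn_stopSlice_stoppedReward M π ht s' s) ((summable_nat_add_iff 1).1 ?_)
  refine .of_nonneg_of_le (fun n => integral_nonneg fun _ => norm_nonneg _) (fun n => ?_)
    (hmass.mul_left (stepReward M π).bound)
  rw [← mul_assoc]
  exact setIntegral_stopSlice_abs_stoppedReward_le M π ht s' s n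

theorem hasSum_runReward :
    HasSum (fun n => runReward M π ht s' n s)
      (∫ ω in stopsAt M s', stoppedReward M ω ∂runMeasure M π t s) := by
  have hint := integrableOn_stopsAt_stoppedReward M π ht s' hmass
  rw [stopsAt_eq_iUnion] at hint
  have hsum := hasSum_integral_iUnion (measurableSet_stopSlice M s')
    (pairwise_disjoint_stopSlice M s') hint
  rw [← stopsAt_eq_iUnion, ← hasSum_nat_add_iff' 1] at hsum
  simp only [setIntegral_stopSlice_stoppedReward M π ht] at hsum
  simpa [setIntegral_measure_zero _ (runMeasure_stopSlice_zero M π ht s' s)] using hsum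

end Run

section StateRecursion

variable {S A : Type*} [Fintype S] [DecidableEq S] [Fintype A] {K : ℕ} {Factor : Fin K → Type*}
  (M : MDP S A K Factor) (π : Policy M)

/-- The averages of `F` over the transitions at which a run with stopping probability `q` per step
stops, weighted with their probabilities. -/
def haltMatrix (q : ℝ) (F : S → A → S → ℝ) : Matrix S S ℝ :=
  hadamardAvg M π M.P fun s a s'' => haltProb M q ⟨some a, some s''⟩ * F s a s''

/-- The averages of `F` over the transitions at which a run with stopping probability `q` per step
goes on, weighted with their probabilities. -/
def survivalMatrix (q : ℝ) (F : S → A → S → ℝ) : Matrix S S ℝ :=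
  hadamardAvg M π M.P fun s a s'' => (1 - haltProb M q ⟨some a, some s''⟩) * F s a s''

theorem integral_stepKernel_eq_mulVec {x : Obs S A} {s : S} (hx : x.state = some s)
    {g : Obs S A → ℝ} {G : S → A → S → ℝ} {v : S → ℝ} (hlost : ∀ a, g ⟨some a, none⟩ = 0)
    (hg : ∀ a s'', g ⟨some a, some s''⟩ = G s a s'' * v s'') :
    ∫ y, g y ∂stepKernel M π x = (hadamardAvg M π M.P G *ᵥ v) s := by
  rw [integral_stepKernel M π hx hlost]
  refine Finset.sum_congr rfl fun s'' _ => ?_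
  change _ = (∑ a ∈ M.avail s, M.P s a s'' * G s a s'' * π.prob s a) * v s''
  rw [Finset.sum_mul]
  exact Finset.sum_congr rfl fun a _ => by rw [hg]; ring

variable {t : ℝ≥0∞} (ht : 1 ≤ t) (s' : S)

theorem stopMass_of_state_eq_none (n : ℕ) {x : Obs S A} (hx : x.state = none) :
    stopMass (stepKernel M π) (stopRule M ht s') n x = 0 := by
  induction n generalizing x with
  | zero =>
    rw [stopMass_zero, stepKernel_of_state_eq_none M π hx, integral_dirac]
    simp [stopRule]
  | succ n ih =>
    rw [stopMass_succ, stepKernel_of_state_eq_none M π hx, integral_dirac, ih rfl, mul_zero]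

theorem stopMass_of_state_eq_some (n : ℕ) {x : Obs S A} {s : S} (hx : x.state = some s) :
    stopMass (stepKernel M π) (stopRule M ht s') n x = runMass M π ht s' n s := by
  have hκ : stepKernel M π x = stepKernel M π ⟨none, some s⟩ := by
    simp only [stepKernel_of_state_eq_some M π (s := s), hx]
  cases n <;> simp only [runMass, stopMass_zero, stopMass_succ, hκ]

theorem stopReward_of_state_eq_some (n : ℕ) {x : Obs S A} {s : S} (hx : x.state = some s) :
    stopReward (stopRule M ht s') (stepReward M π) n x = runReward M π ht s' n s := by
  have hκ : stepKernel M π x = stepKernel M π ⟨none, some s⟩ := by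
    simp only [stepKernel_of_state_eq_some M π (s := s), hx]
  have hvalue (F : S → A → S → ℝ) : stepValue F x = stepValue F ⟨none, some s⟩ := by
    funext y; simp only [stepValue, hx]
  cases n <;> simp only [runReward, stopReward_zero, stopReward_succ, hκ, stepReward, hvalue]

theorem runMass_zero :
    runMass M π ht s' 0 = haltMatrix M π (stopProb t) 1 *ᵥ Pi.single s' 1 := by
  ext s
  rw [runMass, stopMass_zero]
  refine integral_stepKernel_eq_mulVec M π rfl (fun a => by simp [stopRule]) fun a s'' => ?_
  simp [stopRule, Pi.single_apply]

theorem runMass_succ (n : ℕ) :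
    runMass M π ht s' (n + 1) = survivalMatrix M π (stopProb t) 1 *ᵥ runMass M π ht s' n := by
  ext s
  rw [runMass, stopMass_succ]
  refine integral_stepKernel_eq_mulVec M π rfl (fun a => ?_) fun a s'' => ?_
  · rw [stopMass_of_state_eq_none M π ht s' n rfl, mul_zero]
  · rw [stopMass_of_state_eq_some M π ht s' n (s := s'') rfl, Pi.one_apply, Pi.one_apply,
      Pi.one_apply, mul_one]
    rfl

theorem runMass_eq_pow_mulVec (n : ℕ) :
    runMass M π ht s' n = survivalMatrix M π (stopProb t) 1 ^ n *ᵥ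
      (haltMatrix M π (stopProb t) 1 *ᵥ Pi.single s' 1) := by
  induction n with
  | zero => rw [runMass_zero, pow_zero, Matrix.one_mulVec]
  | succ n ih => rw [runMass_succ, ih, pow_succ', Matrix.mulVec_mulVec]

theorem runReward_zero :
    runReward M π ht s' 0 = haltMatrix M π (stopProb t) M.R *ᵥ Pi.single s' 1 := by
  ext s
  rw [runReward, stopReward_zero]
  refine integral_stepKernel_eq_mulVec M π rfl (fun a => by simp [stopRule]) fun a s'' => ?_
  simp [stopRule, stepReward, stepValue, Pi.single_apply]

theorem runReward_succ (n : ℕ) :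
    runReward M π ht s' (n + 1) = survivalMatrix M π (stopProb t) M.R *ᵥ runMass M π ht s' n +
      survivalMatrix M π (stopProb t) M.Γ *ᵥ runReward M π ht s' n := by
  ext s
  rw [runReward, stopReward_succ]
  simp only [mul_add]
  rw [integral_add .of_finite .of_finite]
  refine congrArg₂ _ (integral_stepKernel_eq_mulVec M π rfl (fun a => ?_) fun a s'' => ?_)
    (integral_stepKernel_eq_mulVec M π rfl (fun a => ?_) fun a s'' => ?_)
  · simp [stepReward, stepValue]
  · rw [stopMass_of_state_eq_some M π ht s' n (s := s'') rfl, ← mul_assoc]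
    rfl
  · simp [stepReward, stepValue]
  · rw [stopReward_of_state_eq_some M π ht s' n (s := s'') rfl, ← mul_assoc]
    rfl

include ht in
theorem survivalMatrix_one_nonneg (s s'' : S) : 0 ≤ survivalMatrix M π (stopProb t) 1 s s'' :=
  Finset.sum_nonneg fun a ha => mul_nonneg (mul_nonneg (M.P_nonneg s a ha s'') <| by
    simpa using haltProb_le_one M (stopProb_le_one ht) _) (π.nonneg s a ha)

theorem runMass_nonneg (n : ℕ) : 0 ≤ runMass M π ht s' n := fun _ =>
  stopMass_nonneg (stepKernel M π) _ n _

include ht in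
theorem hasSum_pow_survivalMatrix_mulVec :
    HasSum (fun n => survivalMatrix M π (stopProb t) 1 ^ n *ᵥ
      (haltMatrix M π (stopProb t) 1 *ᵥ Pi.single s' 1)) (fun s => compP M π t s s') := by
  simp only [← runMass_eq_pow_mulVec M π ht s']
  exact Pi.hasSum.2 (hasSum_runMass M π ht s')

theorem summable_succ_mul_runMass (s : S) :
    Summable fun n : ℕ => (n + 1) * runMass M π ht s' n s := by
  simp only [runMass_eq_pow_mulVec]
  exact summable_succ_mul_pow_mulVec (survivalMatrix_one_nonneg M π ht)
    ((runMass_nonneg M π ht s' 0).trans_eq (runMass_zero M π ht s'))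
    (hasSum_pow_survivalMatrix_mulVec M π ht s') s

include ht in
theorem compP_eq_first_step :
    (fun s => compP M π t s s') = haltMatrix M π (stopProb t) 1 *ᵥ Pi.single s' 1 +
      survivalMatrix M π (stopProb t) 1 *ᵥ (fun s => compP M π t s s') :=
  eq_add_mulVec_of_hasSum (hasSum_pow_survivalMatrix_mulVec M π ht s')

variable (t) in
/-- The expectation of `R_{0,τ}` for the run from `s` on the event `{τ < ∞, S_τ = s'}`. -/
def totalReward (s : S) : ℝ := ∫ ω in stopsAt M s', stoppedReward M ω ∂runMeasure M π t s

include ht in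
theorem totalReward_eq_first_step :
    totalReward M π t s' = haltMatrix M π (stopProb t) M.R *ᵥ Pi.single s' 1 +
      (survivalMatrix M π (stopProb t) M.R *ᵥ (fun s => compP M π t s s') +
        survivalMatrix M π (stopProb t) M.Γ *ᵥ totalReward M π t s') := by
  have hreward : HasSum (runReward M π ht s') (totalReward M π t s') := Pi.hasSum.2 fun s =>
    hasSum_runReward M π ht s' (summable_succ_mul_runMass M π ht s' s)
  have hmass : HasSum (runMass M π ht s') (fun s => compP M π t s s') :=
    Pi.hasSum.2 (hasSum_runMass M π ht s')
  have hsucc := (hasSum_mulVec (survivalMatrix M π (stopProb t) M.R) hmass).add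
    (hasSum_mulVec (survivalMatrix M π (stopProb t) M.Γ) hreward)
  simp only [← runReward_succ] at hsucc
  rw [← runReward_zero M π ht s']
  exact hreward.unique hsucc.zero_add

end StateRecursion

section System

variable {S A : Type*} [Fintype S] [DecidableEq S] [Fintype A] {K : ℕ} {Factor : Fin K → Type*}
  (M : MDP S A K Factor) (π : Policy M)

theorem mem_endActions {a : A} : a ∈ M.endActions ↔ M.IsEnd a := by
  simp [MDP.endActions]

theorem endActions_subset_avail (s : S) : M.endActions ⊆ M.avail s := fun a ha =>
  M.end_avail s a ((mem_endActions M).1 ha)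

theorem prob_eq_zero_of_mem_term {s : S} (hs : s ∈ M.term) {a : A} (ha : a ∈ M.avail s)
    (hend : ¬ M.IsEnd a) : π.prob s a = 0 := by
  classical
  have hsum := Finset.sum_sdiff (f := π.prob s) (endActions_subset_avail M s)
  rw [π.sum_eq_one, π.sum_end s hs, add_eq_right, Finset.sum_eq_zero_iff_of_nonneg
    fun b hb => π.nonneg s b (Finset.mem_sdiff.1 hb).1] at hsum
  exact hsum a (Finset.mem_sdiff.2 ⟨ha, mt (mem_endActions M).1 hend⟩)

/-- The probability with which the policy chooses an ending action in a state. -/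
def endProb (s : S) : ℝ := ∑ a ∈ M.endActions, π.prob s a

open Classical in
/-- The reward for choosing an ending action in a state. -/
def endReward (s : S) : ℝ := if s ∈ M.term then 0 else M.r

variable {M} in
theorem prob_pos_of_isEnd {a : A} (ha : M.IsEnd a) (s : S) : 0 < M.P s a s := by
  simp [M.P_end s a s ha]

theorem reward_of_isEnd (s : S) (a : A) (ha : M.IsEnd a) : M.R s a s = endReward M s := by
  have hP := prob_pos_of_isEnd ha s
  unfold endReward
  split_ifs with hs
  · exact M.R_term s hs a (M.end_avail s a ha) s hP
  · exact M.R_end s hs a ha s hP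

theorem discount_of_isEnd (s : S) (a : A) (ha : M.IsEnd a) : M.Γ s a s = 1 :=
  M.Γ_end s a ha s (prob_pos_of_isEnd ha s)

theorem sum_endActions_eq_diagonal {F : S → A → S → ℝ} {c : S → ℝ}
    (hF : ∀ s a, M.IsEnd a → F s a s = c s) (s s'' : S) :
    ∑ a ∈ M.endActions, M.P s a s'' * F s a s'' * π.prob s a =
      Matrix.diagonal (fun s => c s * endProb M π s) s s'' := by
  rcases eq_or_ne s s'' with rfl | hne
  · rw [Matrix.diagonal_apply_eq, endProb, Finset.mul_sum]
    refine Finset.sum_congr rfl fun a ha => ?_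
    have hend := (mem_endActions M).1 ha
    rw [M.P_end s a s hend, if_pos rfl, one_mul, hF s a hend]
  · rw [Matrix.diagonal_apply_ne _ hne]
    refine Finset.sum_eq_zero fun a ha => ?_
    rw [M.P_end s a s'' ((mem_endActions M).1 ha), if_neg hne.symm, zero_mul, zero_mul]

theorem endMatrix_eq_diagonal : endMatrix M π = Matrix.diagonal (endProb M π) := by
  ext s s''
  have hsum := sum_endActions_eq_diagonal M π (F := 1) (c := 1) (fun _ _ _ => rfl) s s''
  simp only [Pi.one_apply, mul_one, one_mul] at hsum
  exact hsum

variable {q : ℝ} {F : S → A → S → ℝ} {c : S → ℝ}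

theorem haltMatrix_eq (hF : ∀ s a, M.IsEnd a → F s a s = c s) :
    haltMatrix M π q F = q • hadamardAvg M π M.P F +
      (1 - q) • Matrix.diagonal fun s => c s * endProb M π s := by
  classical
  ext s s''
  have hend : M.endActions = {a ∈ M.avail s | M.IsEnd a} := by
    ext a
    rw [Finset.mem_filter, mem_endActions]
    exact ⟨fun h => ⟨M.end_avail s a h, h⟩, And.right⟩
  rw [Matrix.add_apply, Matrix.smul_apply, Matrix.smul_apply, ← sum_endActions_eq_diagonal M π hF,
    hend, Finset.sum_filter, smul_eq_mul, smul_eq_mul]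
  simp only [haltMatrix, hadamardAvg, Matrix.of_apply, Finset.mul_sum, ← Finset.sum_add_distrib]
  refine Finset.sum_congr rfl fun a _ => ?_
  by_cases h : M.IsEnd a <;> simp [haltProb, Obs.IsEnd, h] <;> ring

theorem haltMatrix_add_survivalMatrix :
    haltMatrix M π q F + survivalMatrix M π q F = hadamardAvg M π M.P F := by
  ext s s''
  simp only [haltMatrix, survivalMatrix, hadamardAvg, Matrix.add_apply, Matrix.of_apply,
    ← Finset.sum_add_distrib]
  exact Finset.sum_congr rfl fun a _ => by ring

theorem survivalMatrix_eq (hF : ∀ s a, M.IsEnd a → F s a s = c s) :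
    survivalMatrix M π q F = (1 - q) • (hadamardAvg M π M.P F -
      Matrix.diagonal fun s => c s * endProb M π s) := by
  rw [eq_sub_of_add_eq' (haltMatrix_add_survivalMatrix M π), haltMatrix_eq M π hF]
  module

theorem haltMatrix_mulVec (hF : ∀ s a, M.IsEnd a → F s a s = c s) (v : S → ℝ) (s : S) :
    (haltMatrix M π q F *ᵥ v) s = q * (hadamardAvg M π M.P F *ᵥ v) s +
      (1 - q) * (c s * endProb M π s * v s) := by
  rw [haltMatrix_eq M π hF, Matrix.add_mulVec, Matrix.smul_mulVec, Matrix.smul_mulVec,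
    Pi.add_apply, Pi.smul_apply, Pi.smul_apply, Matrix.mulVec_diagonal, smul_eq_mul, smul_eq_mul]

theorem survivalMatrix_mulVec (hF : ∀ s a, M.IsEnd a → F s a s = c s) (v : S → ℝ) (s : S) :
    (survivalMatrix M π q F *ᵥ v) s =
      (1 - q) * ((hadamardAvg M π M.P F *ᵥ v) s - c s * endProb M π s * v s) := by
  rw [survivalMatrix_eq M π hF, Matrix.smul_mulVec, Matrix.sub_mulVec, Pi.smul_apply,
    Pi.sub_apply, Matrix.mulVec_diagonal, smul_eq_mul]

variable {s : S} (hs : s ∈ M.term)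
include hs

theorem survivalMatrix_mulVec_of_mem_term (v : S → ℝ) : (survivalMatrix M π q F *ᵥ v) s = 0 := by
  refine Finset.sum_eq_zero fun s'' _ => mul_eq_zero_of_left (Finset.sum_eq_zero fun a ha => ?_) _
  by_cases h : M.IsEnd a
  · simp [haltProb, Obs.IsEnd, h]
  · rw [prob_eq_zero_of_mem_term M π hs ha h, mul_zero]

theorem haltMatrix_mulVec_of_mem_term (hF : ∀ s a, M.IsEnd a → F s a s = c s) (v : S → ℝ) :
    (haltMatrix M π q F *ᵥ v) s = c s * v s := by
  have hendProb : endProb M π s = 1 := π.sum_end s hs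
  have hsurvival := survivalMatrix_mulVec M π (q := 0) hF v s
  rw [survivalMatrix_mulVec_of_mem_term M π hs, hendProb] at hsurvival
  rw [haltMatrix_mulVec M π hF, hendProb]
  linear_combination -q * hsurvival

variable {t : ℝ≥0∞} (ht : 1 ≤ t) (s' : S)
include ht

theorem compP_of_mem_term : compP M π t s s' = (Pi.single s' 1 : S → ℝ) s := by
  rw [congrFun (compP_eq_first_step M π ht s') s, Pi.add_apply,
    survivalMatrix_mulVec_of_mem_term M π hs,
    haltMatrix_mulVec_of_mem_term M π hs (F := 1) (c := 1) (fun _ _ _ => rfl),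
    Pi.one_apply, one_mul, add_zero]

theorem totalReward_of_mem_term : totalReward M π t s' s = 0 := by
  rw [totalReward_eq_first_step M π ht, Pi.add_apply, Pi.add_apply,
    survivalMatrix_mulVec_of_mem_term M π hs, survivalMatrix_mulVec_of_mem_term M π hs,
    haltMatrix_mulVec_of_mem_term M π hs (reward_of_isEnd M), endReward, if_pos hs]
  ring

end System

section ConditionalExpectation

variable {S A : Type*} [Fintype S] [DecidableEq S] [Fintype A] {K : ℕ} {Factor : Fin K → Type*}
  (M : MDP S A K Factor) (π : Policy M)

theorem compP_nonneg (t : ℝ≥0∞) (s s' : S) : 0 ≤ compP M π t s s' := ENNReal.toReal_nonneg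

theorem condReward_eq (t : ℝ≥0∞) (s s' : S) :
    condReward M π t s s' = (compP M π t s s')⁻¹ * totalReward M π t s' s := by
  rw [condReward, ProbabilityTheory.cond, integral_smul_measure, ENNReal.toReal_inv]
  rfl

variable {t : ℝ≥0∞} (ht : 1 ≤ t) (s s' : S)
include ht

theorem compP_mul_condReward :
    compP M π t s s' * condReward M π t s s' = totalReward M π t s' s := by
  have := isProbabilityMeasure_runMeasure M π ht s
  rw [condReward_eq]
  by_cases h : compP M π t s s' = 0
  · rw [h, zero_mul, totalReward,
      setIntegral_measure_zero _ ((measureReal_eq_zero_iff (measure_ne_top _ _)).1 h)]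
  · rw [mul_inv_cancel_left₀ h]

theorem compR_eq_condReward : compR M π t s s' = condReward M π t s s' := by
  unfold compR
  split_ifs with hs
  · rw [condReward_eq, totalReward_of_mem_term M π hs ht, mul_zero]
  · rfl

theorem integrable_cond_stoppedReward {s s' : S} (hs : 0 < compP M π t s s') :
    Integrable (stoppedReward M)
      (ProbabilityTheory.cond (runMeasure M π t s) (stopsAt M s')) :=
  (integrableOn_stopsAt_stoppedReward M π ht s'
    (summable_succ_mul_runMass M π ht s' s)).smul_measure
      (ENNReal.inv_ne_top.2 (ENNReal.toReal_pos_iff.1 hs).1.ne')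

end ConditionalExpectation

section LinearSystem

variable {S A : Type*} [Fintype S] [DecidableEq S] [Fintype A] {K : ℕ} {Factor : Fin K → Type*}
  (M : MDP S A K Factor) (π : Policy M) {t : ℝ≥0∞} {s' : S}

/-- The vector `P⁺(·, π, s') h` on the whole state space: the unknown in terms of which the
conditional expectations turn back into expectations. -/
def compWeighted (h : Supp M π t s' → ℝ) (s : S) : ℝ :=
  compP M π t s s' * Function.extend Subtype.val h 0 s

theorem compWeighted_coe (h : Supp M π t s' → ℝ) (s : Supp M π t s') :
    compWeighted M π h s = compP M π t s s' * h s := by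
  rw [compWeighted, Subtype.val_injective.extend_apply]

theorem compWeighted_of_compP_le (h : Supp M π t s' → ℝ) {s : S} (hs : compP M π t s s' ≤ 0) :
    compWeighted M π h s = 0 := by
  rw [compWeighted, hs.antisymm (compP_nonneg M π t s s'), zero_mul]

theorem abs_compWeighted_le {h : Supp M π t s' → ℝ} {C : ℝ} (hC : ∀ s, |h s| ≤ C) (s : S) :
    |compWeighted M π h s| ≤ C * compP M π t s s' := by
  rcases lt_or_ge 0 (compP M π t s s') with hs | hs
  · rw [compWeighted_coe M π h ⟨s, hs⟩, abs_mul, abs_of_pos hs, mul_comm]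
    exact mul_le_mul_of_nonneg_right (hC ⟨s, hs⟩) hs.le
  · rw [compWeighted_of_compP_le M π h hs, hs.antisymm (compP_nonneg M π t s s'), abs_zero,
      mul_zero]

theorem compWeighted_sub (h k : Supp M π t s' → ℝ) :
    compWeighted M π (h - k) = compWeighted M π h - compWeighted M π k := by
  ext s
  rcases lt_or_ge 0 (compP M π t s s') with hs | hs
  · rw [Pi.sub_apply]
    simp only [compWeighted_coe M π _ ⟨s, hs⟩, Pi.sub_apply, mul_sub]
  · simp only [Pi.sub_apply, compWeighted_of_compP_le M π _ hs, sub_zero]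

theorem compWeighted_one : compWeighted M π (1 : Supp M π t s' → ℝ) = (compP M π t · s') := by
  ext s
  rcases lt_or_ge 0 (compP M π t s s') with hs | hs
  · rw [compWeighted_coe M π 1 ⟨s, hs⟩, Pi.one_apply, mul_one]
  · rw [compWeighted_of_compP_le M π 1 hs, hs.antisymm (compP_nonneg M π t s s')]

theorem compWeighted_compR (ht : 1 ≤ t) :
    compWeighted M π (fun s : Supp M π t s' => compR M π t s s') = totalReward M π t s' := by
  ext s
  rw [← compP_mul_condReward M π ht, ← compR_eq_condReward M π ht]
  rcases lt_or_ge 0 (compP M π t s s') with hs | hs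
  · exact compWeighted_coe M π _ ⟨s, hs⟩
  · rw [compWeighted_of_compP_le M π _ hs, hs.antisymm (compP_nonneg M π t s s'), zero_mul]

theorem hadamardAvg_doobPbar_apply (F : S → A → S → ℝ) (s s'' : S) :
    hadamardAvg M π (doobPbar M π t s') F s s'' =
      (compP M π t s s')⁻¹ * hadamardAvg M π M.P F s s'' := by
  simp only [hadamardAvg, doobPbar, Matrix.of_apply, Finset.mul_sum]
  exact Finset.sum_congr rfl fun a _ => by ring

theorem restrictSq_hadamardAvg_doobP_mulVec (F : S → A → S → ℝ) (h : Supp M π t s' → ℝ)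
    (s : Supp M π t s') :
    (restrictSq M π t s' (hadamardAvg M π (doobP M π t s') F) *ᵥ h) s =
      (compP M π t s s')⁻¹ * (hadamardAvg M π M.P F *ᵥ compWeighted M π h) s := by
  have hentry (s'' : S) : hadamardAvg M π (doobP M π t s') F s s'' =
      (compP M π t s s')⁻¹ * hadamardAvg M π M.P F s s'' * compP M π t s'' s' := by
    simp only [hadamardAvg, doobP, Matrix.of_apply, Finset.mul_sum, Finset.sum_mul]
    exact Finset.sum_congr rfl fun a _ => by ring
  rw [Matrix.mulVec, dotProduct, Matrix.mulVec, dotProduct, Finset.mul_sum]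
  refine Fintype.sum_of_injective _ Subtype.val_injective _ _ (fun s'' hs'' => ?_) fun s'' => ?_
  · rw [compWeighted_of_compP_le, mul_zero, mul_zero]
    exact not_lt.1 fun h => hs'' ⟨⟨s'', h⟩, rfl⟩
  · rw [restrictSq, Matrix.submatrix_apply, hentry, compWeighted_coe]
    ring

theorem restrictSq_endMatrix_mulVec (h : Supp M π t s' → ℝ) (s : Supp M π t s') :
    (restrictSq M π t s' (endMatrix M π) *ᵥ h) s = endProb M π s * h s := by
  rw [restrictSq, endMatrix_eq_diagonal, Matrix.submatrix_diagonal _ _ Subtype.val_injective,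
    Matrix.mulVec_diagonal, Function.comp_apply]

theorem endMatrix_mulVec (v : S → ℝ) (s : S) : (endMatrix M π *ᵥ v) s = endProb M π s * v s := by
  rw [endMatrix_eq_diagonal, Matrix.mulVec_diagonal]

theorem restrictRows_mulVec (B : Matrix S S ℝ) (v : S → ℝ) (s : Supp M π t s') :
    (restrictRows M π t s' B *ᵥ v) s = (B *ᵥ v) s := rfl

theorem endReward_sub_mul_eq_zero (ht : 1 ≤ t) (s : S) :
    (endReward M s - M.r) * ((Pi.single s' 1 : S → ℝ) s - compP M π t s s') = 0 := by
  by_cases hs : s ∈ M.term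
  · rw [compP_of_mem_term M π hs ht, sub_self, mul_zero]
  · rw [endReward, if_neg hs, sub_self, zero_mul]

theorem solvesRewardSystem_iff (ht : 1 ≤ t) (h : Supp M π t s' → ℝ) :
    SolvesRewardSystem M π t s' h ↔ ∀ s : Supp M π t s', compWeighted M π h s =
      (haltMatrix M π (stopProb t) M.R *ᵥ Pi.single s' 1 +
        (survivalMatrix M π (stopProb t) M.R *ᵥ (fun s => compP M π t s s') +
          survivalMatrix M π (stopProb t) M.Γ *ᵥ compWeighted M π h)) s := by
  rw [SolvesRewardSystem, funext_iff]
  refine forall_congr' fun s => ?_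
  have hinv : compP M π t s s' * (compP M π t s s')⁻¹ = 1 := mul_inv_cancel₀ s.2.ne'
  have hterm := endReward_sub_mul_eq_zero M π (s' := s') ht s
  have hbar : (hadamardAvg M π (doobPbar M π t s') M.R *ᵥ Pi.single s' 1) s.1 =
      (compP M π t s s')⁻¹ * (hadamardAvg M π M.P M.R *ᵥ Pi.single s' 1) s := by
    simp only [Matrix.mulVec_single_one, Matrix.col_apply, hadamardAvg_doobPbar_apply]
  simp only [Matrix.add_mulVec, Matrix.one_mulVec, Matrix.smul_mulVec, Matrix.sub_mulVec,
    Pi.add_apply, Pi.sub_apply, Pi.smul_apply, smul_eq_mul, Pi.one_apply,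
    diagonal_inv_mulVec (fun s : Supp M π t s' => s.2.ne'), restrictSq_endMatrix_mulVec,
    restrictSq_hadamardAvg_doobP_mulVec, compWeighted_one, restrictRows_mulVec, hbar,
    endMatrix_mulVec,
    haltMatrix_mulVec M π (reward_of_isEnd M), survivalMatrix_mulVec M π (reward_of_isEnd M),
    survivalMatrix_mulVec M π (F := M.Γ) (c := 1) (discount_of_isEnd M)]
  rw [← mul_right_inj' s.2.ne', compWeighted_coe]
  set laterReward := (hadamardAvg M π M.P M.Γ *ᵥ compWeighted M π h) s.1
  set runningReward := (hadamardAvg M π M.P M.R *ᵥ fun s => compP M π t s s') s.1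
  set finalReward := (hadamardAvg M π M.P M.R *ᵥ Pi.single s' 1) s.1
  set δ := (Pi.single s' 1 : S → ℝ) s.1
  set c := (1 - stopProb t) * (laterReward + runningReward + M.r * endProb M π s * δ) +
    stopProb t * finalReward
  constructor <;> intro hrow
  · linear_combination hrow + c * hinv - (1 - stopProb t) * endProb M π s * hterm
  · linear_combination hrow - c * hinv + (1 - stopProb t) * endProb M π s * hterm

theorem abs_survivalMatrix_discount_le (ht : 1 ≤ t) (s s'' : S) :
    |survivalMatrix M π (stopProb t) M.Γ s s''| ≤ survivalMatrix M π (stopProb t) 1 s s'' := by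
  refine (Finset.abs_sum_le_sum_abs _ _).trans (Finset.sum_le_sum fun a ha => ?_)
  have hP := M.P_nonneg s a ha s''
  have hhalt := sub_nonneg.2 (haltProb_le_one M (stopProb_le_one ht) ⟨some a, some s''⟩)
  rw [abs_mul, abs_of_nonneg (π.nonneg s a ha)]
  refine mul_le_mul_of_nonneg_right ?_ (π.nonneg s a ha)
  rcases hP.eq_or_lt with hP | hP
  · simp only [← hP, zero_mul, abs_zero, le_refl]
  · rw [abs_mul, abs_mul, abs_of_pos hP, abs_of_nonneg hhalt,
      abs_of_nonneg (M.Γ_nonneg s a ha s'' hP)]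
    exact mul_le_mul_of_nonneg_left
      (mul_le_mul_of_nonneg_left (M.Γ_le_one s a ha s'' hP) hhalt) hP.le

theorem SolvesRewardSystem.unique (ht : 1 ≤ t) {h k : Supp M π t s' → ℝ}
    (hh : SolvesRewardSystem M π t s' h) (hk : SolvesRewardSystem M π t s' k) : h = k := by
  rw [solvesRewardSystem_iff M π ht] at hh hk
  have hhomogeneous (s : Supp M π t s') : compWeighted M π (h - k) s =
      (survivalMatrix M π (stopProb t) M.Γ *ᵥ compWeighted M π (h - k)) s := by
    rw [compWeighted_sub, Matrix.mulVec_sub, Pi.sub_apply, hh, hk]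
    simp only [Pi.add_apply, Pi.sub_apply]
    ring
  have hsub : |compWeighted M π (h - k)| ≤
      survivalMatrix M π (stopProb t) 1 *ᵥ |compWeighted M π (h - k)| := fun s => by
    rcases lt_or_ge 0 (compP M π t s s') with hs | hs
    · rw [Pi.abs_apply, hhomogeneous ⟨s, hs⟩]
      exact abs_mulVec_le (abs_survivalMatrix_discount_le M π ht) _ s
    · rw [Pi.abs_apply, compWeighted_of_compP_le M π _ hs, abs_zero]
      exact Finset.sum_nonneg fun s'' _ =>
        mul_nonneg (survivalMatrix_one_nonneg M π ht s s'') (abs_nonneg _)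
  obtain ⟨C, hC⟩ := (Set.finite_range fun s => |(h - k) s|).bddAbove
  have hzero : compWeighted M π (h - k) = 0 :=
    eq_zero_of_abs_le_mulVec_abs (survivalMatrix_one_nonneg M π ht)
      (tendsto_pow_mulVec_of_hasSum (hasSum_pow_survivalMatrix_mulVec M π ht s'))
      (fun s => abs_compWeighted_le M π (fun s => hC ⟨s, rfl⟩) s) hsub
  ext s
  have hs := congrFun hzero s
  rw [compWeighted_coe, Pi.zero_apply, mul_eq_zero, or_iff_right s.2.ne'] at hs
  exact sub_eq_zero.1 hs

end LinearSystem

end CompressMDP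

end

open CompressMDP in
theorem mainTheorem8 {S A : Type*} [Fintype S] [DecidableEq S] [Fintype A]
    {K : ℕ} {Factor : Fin K → Type*} (M : MDP S A K Factor) (π : Policy M)
    (t : ℝ≥0∞) (ht : 1 ≤ t) (s' : S) :
    (∀ s : Supp M π t s',
      MeasureTheory.Integrable (stoppedReward M)
        (ProbabilityTheory.cond (runMeasure M π t s) (stopsAt M s')) ∧
      compR M π t s s' = condReward M π t s s') ∧
    (∃ C : ℝ, ∀ s : Supp M π t s', |compR M π t s s'| ≤ C) ∧
    SolvesRewardSystem M π t s' (fun s : Supp M π t s' => compR M π t s s') ∧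
    ∀ h : Supp M π t s' → ℝ, SolvesRewardSystem M π t s' h →
      h = fun s : Supp M π t s' => compR M π t s s' := by
  have hsolves : SolvesRewardSystem M π t s' fun s => compR M π t s s' := by
    rw [solvesRewardSystem_iff M π ht, compWeighted_compR M π ht]
    exact fun s => congrFun (totalReward_eq_first_step M π ht s') s
  obtain ⟨C, hC⟩ := (Set.finite_range fun s : Supp M π t s' => |compR M π t s s'|).bddAbove
  exact ⟨fun s => ⟨integrable_cond_stoppedReward M π ht s.2, compR_eq_condReward M π ht s s'⟩,
    ⟨C, fun s => hC ⟨s, rfl⟩⟩, hsolves, fun _ hh => hh.unique M π ht hsolves⟩
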